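/- Let $\Bbbk$ be a field and $Q$ a quiver (loops, multiple arrows and infinitely many vertices or arrows are allowed). The path coalgebra $\Bbbk Q$ has the paths of $Q$ (including the trivial ones) as a basis, with $\Delta(p)=\sum_{xy=p}x\otimes y$ ($xy$ denotes first $x$, then $y$), and $\varepsilon(p)=1$ if $p$ is trivial, $\varepsilon(p)=0$ otherwise. A subcoalgebra $C\subseteq \Bbbk Q$ is admissible if it contains all vertices and all arrows of $Q$. A multipath is a linear combination $p$ of paths that all have the same source and the same target, the latter denoted $t(p)$. A set $F$ of multipaths in $C$ is independent if it is linearly independent and $\langle x\rangle^C\cap F=\{x\}$ for every $x\in F$, where $\langle x\rangle^C$ is the right coideal of $C$ generated by $x$ (the smallest subspace $I\subseteq C$ with $x\in I$ and $\Delta(I)\subseteq I\otimes C$). For a quiver $Q$ and a subcoalgebra $C\subseteq\Bbbk Q$, let $\overline Q$ be the quiver obtained from $Q$ by adding, for each finite independent set $F=\{p_1,\dots,p_n\}$ of multipaths in $C$, a new vertex $e_F$ and $n$ different arrows $\alpha_{i,F}\colon t(p_i)\to e_F$, $1\le i\le n$. Put $q_F=\sum_{i=1}^n p_i\alpha_{i,F}\in\Bbbk\overline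 Q$, and let $\overline C\subseteq \Bbbk\overline Q$ be the subcoalgebra generated by $C$ and all the elements $q_F$. Set $T^0(Q)=Q$, $T^0(C)=C$, $T^{n+1}(Q)=\overline{T^n(Q)}$ and $T^{n+1}(C)=\overline{T^n(C)}$ (the construction being applied to $T^n(C)\subseteq\Bbbk T^n(Q)$), and let $T(Q)=\bigcup_n T^n(Q)$. The tail closure of $C$ is the subcoalgebra $T(C)=\bigcup_n T^n(C)$ of $\Bbbk T(Q)$. **Theorem.** Let $C\subseteq\Bbbk Q$ be an admissible subcoalgebra. Then $T(C)$ is a generator of the category of left $T(C)$-comodules: every left $T(C)$-comodule $X$ admits an epimorphism from a coproduct of copies of $T(C)$ in that category. Equivalently, $T(C)$ is left f-qcF, and this too is part of the claim: every finite dimensional right $T(C)$-comodule $M$, regarded as a left module over the dual algebra $T(C)^*$ (with the convolution product) by $f\rightharpoonup m=\sum m_0f(m_1)$, embeds in a free left $T(C)^*$-module. -/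

import Mathlib

open TensorProduct CategoryTheory

universe u

/-! ### Subcoalgebras and coideals -/

section Coalgebras

variable {k A : Type u} [Field k] [AddCommGroup A] [Module k A]

/-- For subspaces `D, E` of `A`, the subspace `D ⊗ E` of `A ⊗ A`. -/
def tensorSub (D E : Submodule k A) : Submodule k (A ⊗[k] A) :=
  LinearMap.range (TensorProduct.map D.subtype E.subtype)

theorem tensor_eq_zero_of_right {B : Type u} [AddCommGroup B] [Module k B] (z : B ⊗[k] A)
    (h : ∀ f : A →ₗ[k] k, TensorProduct.rid k B (f.lTensor B z) = 0) : z = 0 := by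
  classical
  let b := Module.Basis.ofVectorSpace k A
  apply (TensorProduct.equivFinsuppOfBasisRight (M := B) b).injective
  ext i
  rw [TensorProduct.equivFinsuppOfBasisRight_apply, h]
  simp

theorem tensor_eq_zero_of_left {B : Type u} [AddCommGroup B] [Module k B] (z : A ⊗[k] B)
    (h : ∀ f : A →ₗ[k] k, TensorProduct.lid k B (f.rTensor B z) = 0) : z = 0 := by
  classical
  let b := Module.Basis.ofVectorSpace k A
  apply (TensorProduct.equivFinsuppOfBasisLeft (N := B) b).injective
  ext i
  rw [TensorProduct.equivFinsuppOfBasisLeft_apply, h]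
  simp

/-- Over a field, membership in `D ⊗ D` is tested by contracting with functionals. -/
theorem mem_tensorSub_iff (D : Submodule k A) (z : A ⊗[k] A) :
    z ∈ tensorSub D D ↔ ∀ f : A →ₗ[k] k,
      TensorProduct.rid k A (f.lTensor A z) ∈ D ∧ TensorProduct.lid k A (f.rTensor A z) ∈ D := by
  constructor
  · rintro ⟨w, rfl⟩ f
    induction w with
    | zero => simp
    | add x y hx hy =>
      simp only [map_add]
      exact ⟨D.add_mem hx.1 hy.1, D.add_mem hx.2 hy.2⟩
    | tmul x y =>
      simp only [map_tmul, Submodule.subtype_apply, LinearMap.lTensor_tmul, rid_tmul,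
        LinearMap.rTensor_tmul, lid_tmul]
      exact ⟨D.smul_mem _ x.2, D.smul_mem _ y.2⟩
  · intro h
    obtain ⟨g, hg⟩ := LinearMap.exists_leftInverse_of_injective D.subtype D.ker_subtype
    have hP : ∀ x ∈ D, D.subtype (g x) = x := by
      intro x hx
      have := LinearMap.congr_fun hg ⟨x, hx⟩
      simp only [LinearMap.comp_apply, Submodule.subtype_apply, LinearMap.id_apply] at this
      simp [this]
    have h1 : (D.subtype ∘ₗ g).rTensor A z = z := by
      rw [← sub_eq_zero]
      apply tensor_eq_zero_of_right
      intro f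
      have e : ∀ w : A ⊗[k] A, TensorProduct.rid k A (f.lTensor A ((D.subtype ∘ₗ g).rTensor A w)) =
          D.subtype (g (TensorProduct.rid k A (f.lTensor A w))) := by
        intro w
        induction w with
        | zero => simp
        | add x y hx hy => simp only [map_add, hx, hy]
        | tmul x y => simp
      rw [map_sub, map_sub, e, hP _ (h f).1, sub_self]
    have h2 : (D.subtype ∘ₗ g).lTensor A z = z := by
      rw [← sub_eq_zero]
      apply tensor_eq_zero_of_left
      intro f
      have e : ∀ w : A ⊗[k] A, TensorProduct.lid k A (f.rTensor A ((D.subtype ∘ₗ g).lTensor A w)) =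
          D.subtype (g (TensorProduct.lid k A (f.rTensor A w))) := by
        intro w
        induction w with
        | zero => simp
        | add x y hx hy => simp only [map_add, hx, hy]
        | tmul x y => simp
      rw [map_sub, map_sub, e, hP _ (h f).2, sub_self]
    refine ⟨TensorProduct.map g g z, ?_⟩
    rw [← LinearMap.comp_apply, ← TensorProduct.map_comp]
    conv_rhs => rw [← h2, ← h1]
    rw [← LinearMap.comp_apply, LinearMap.lTensor_comp_rTensor]

theorem tensorSub_mono {D E : Submodule k A} (h : D ≤ E) : tensorSub D D ≤ tensorSub E E := by
  intro z hz
  rw [mem_tensorSub_iff] at hz ⊢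
  exact fun f => ⟨h (hz f).1, h (hz f).2⟩

theorem tensorSub_subtype_injective (D : Submodule k A) :
    Function.Injective (TensorProduct.map D.subtype D.subtype) := by
  rw [← LinearMap.lTensor_comp_rTensor]
  exact (Module.Flat.lTensor_preserves_injective_linearMap _ D.subtype_injective).comp
    (Module.Flat.rTensor_preserves_injective_linearMap _ D.subtype_injective)

variable [Coalgebra k A]

variable (k A) in
/-- A subcoalgebra of `A`: a subspace `D` with `Δ(D) ⊆ D ⊗ D`. -/
@[ext] structure Subcoalgebra where
  toSubmodule : Submodule k A
  comul_mem : ∀ x ∈ toSubmodule, Coalgebra.comul (R := k) x ∈ tensorSub toSubmodule toSubmodule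

namespace Subcoalgebra

/-- The restriction of the comultiplication to a subcoalgebra. -/
noncomputable def comulAux (D : Subcoalgebra k A) :
    D.toSubmodule →ₗ[k] D.toSubmodule ⊗[k] D.toSubmodule :=
  (LinearEquiv.ofInjective _ (tensorSub_subtype_injective D.toSubmodule)).symm.toLinearMap ∘ₗ
    LinearMap.codRestrict _ (Coalgebra.comul ∘ₗ D.toSubmodule.subtype)
      (fun x => D.comul_mem x.1 x.2)

theorem map_comulAux (D : Subcoalgebra k A) (x : D.toSubmodule) :
    TensorProduct.map D.toSubmodule.subtype D.toSubmodule.subtype (D.comulAux x) =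
      Coalgebra.comul (R := k) (x : A) := by
  have := LinearEquiv.apply_symm_apply
    (LinearEquiv.ofInjective _ (tensorSub_subtype_injective D.toSubmodule))
    (LinearMap.codRestrict _ (Coalgebra.comul ∘ₗ D.toSubmodule.subtype)
      (fun x => D.comul_mem x.1 x.2) x)
  exact congrArg Subtype.val this

/-- A subcoalgebra is a coalgebra, with the restricted comultiplication and counit. -/
noncomputable instance (D : Subcoalgebra k A) : Coalgebra k D.toSubmodule where
  comul := D.comulAux
  counit := Coalgebra.counit ∘ₗ D.toSubmodule.subtype
  coassoc := by
    ext x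
    have hinj : Function.Injective (TensorProduct.map D.toSubmodule.subtype
        (TensorProduct.map D.toSubmodule.subtype D.toSubmodule.subtype)) := by
      rw [← LinearMap.lTensor_comp_rTensor]
      exact (Module.Flat.lTensor_preserves_injective_linearMap _
        (tensorSub_subtype_injective D.toSubmodule)).comp
        (Module.Flat.rTensor_preserves_injective_linearMap _ D.toSubmodule.subtype_injective)
    apply hinj
    have e1 : ∀ w : D.toSubmodule ⊗[k] D.toSubmodule,
        TensorProduct.map D.toSubmodule.subtype
        (TensorProduct.map D.toSubmodule.subtype D.toSubmodule.subtype)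
        (TensorProduct.assoc k _ _ _ (D.comulAux.rTensor _ w)) =
        TensorProduct.assoc k _ _ _ ((Coalgebra.comul (R := k)).rTensor A
          (TensorProduct.map D.toSubmodule.subtype D.toSubmodule.subtype w)) := by
      intro w
      induction w with
      | zero => simp
      | add x y hx hy => simp only [map_add, hx, hy]
      | tmul x y =>
        simp only [LinearMap.rTensor_tmul, map_tmul, Submodule.subtype_apply]
        rw [← D.map_comulAux x]
        generalize D.comulAux x = v
        induction v with
        | zero => simp
        | add x y hx hy => simp only [map_add, add_tmul, hx, hy]
        | tmul x y => simp
    have e2 : ∀ w : D.toSubmodule ⊗[k] D.toSubmodule,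
        TensorProduct.map D.toSubmodule.subtype
        (TensorProduct.map D.toSubmodule.subtype D.toSubmodule.subtype)
        (D.comulAux.lTensor _ w) =
        (Coalgebra.comul (R := k)).lTensor A
          (TensorProduct.map D.toSubmodule.subtype D.toSubmodule.subtype w) := by
      intro w
      induction w with
      | zero => simp
      | add x y hx hy => simp only [map_add, hx, hy]
      | tmul x y =>
        simp only [LinearMap.lTensor_tmul, map_tmul, Submodule.subtype_apply, D.map_comulAux]
    simp only [LinearMap.comp_apply, LinearEquiv.coe_coe]
    rw [e1, e2, D.map_comulAux, Coalgebra.coassoc_apply]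
  rTensor_counit_comp_comul := by
    ext x
    have e : ∀ w : D.toSubmodule ⊗[k] D.toSubmodule,
        D.toSubmodule.subtype.lTensor k
          ((Coalgebra.counit ∘ₗ D.toSubmodule.subtype).rTensor _ w) =
        (Coalgebra.counit (R := k)).rTensor A
          (TensorProduct.map D.toSubmodule.subtype D.toSubmodule.subtype w) := by
      intro w
      induction w with
      | zero => simp
      | add x y hx hy => simp only [map_add, hx, hy]
      | tmul x y => simp
    apply Module.Flat.lTensor_preserves_injective_linearMap (M := k) _
      D.toSubmodule.subtype_injective
    rw [LinearMap.comp_apply, e, D.map_comulAux, Coalgebra.rTensor_counit_comul]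
    simp
  lTensor_counit_comp_comul := by
    ext x
    have e : ∀ w : D.toSubmodule ⊗[k] D.toSubmodule,
        D.toSubmodule.subtype.rTensor k
          ((Coalgebra.counit ∘ₗ D.toSubmodule.subtype).lTensor _ w) =
        (Coalgebra.counit (R := k)).lTensor A
          (TensorProduct.map D.toSubmodule.subtype D.toSubmodule.subtype w) := by
      intro w
      induction w with
      | zero => simp
      | add x y hx hy => simp only [map_add, hx, hy]
      | tmul x y => simp
    apply Module.Flat.rTensor_preserves_injective_linearMap (M := k) _
      D.toSubmodule.subtype_injective
    rw [LinearMap.comp_apply, e, D.map_comulAux, Coalgebra.lTensor_counit_comul]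
    simp

/-- The subcoalgebra generated by a set: the smallest subcoalgebra containing it. -/
def generated (S : Set A) : Subcoalgebra k A where
  toSubmodule := sInf {D | ∃ E : Subcoalgebra k A, E.toSubmodule = D ∧ S ⊆ D}
  comul_mem := by
    intro x hx
    rw [mem_tensorSub_iff]
    rw [Submodule.mem_sInf] at hx
    intro f
    simp only [Submodule.mem_sInf]
    constructor <;> rintro _ ⟨E, rfl, hS⟩
    · exact ((mem_tensorSub_iff _ _).1 (E.comul_mem x (hx _ ⟨E, rfl, hS⟩)) f).1
    · exact ((mem_tensorSub_iff _ _).1 (E.comul_mem x (hx _ ⟨E, rfl, hS⟩)) f).2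

/-- The sum of a family of subcoalgebras; for an increasing sequence this is the union. -/
def iSup {ι : Type} (D : ι → Subcoalgebra k A) : Subcoalgebra k A where
  toSubmodule := ⨆ i, (D i).toSubmodule
  comul_mem := by
    intro x hx
    induction hx using Submodule.iSup_induction' with
    | mem i x hx =>
      exact tensorSub_mono (le_iSup (fun i => (D i).toSubmodule) i)
          ((D i).comul_mem x hx)
    | zero => simp
    | add x y _ _ hx hy => rw [map_add]; exact Submodule.add_mem _ hx hy

/-- The image of a subcoalgebra under a coalgebra morphism. -/
def map {B : Type u} [AddCommGroup B] [Module k B] [Coalgebra k B] (φ : A →ₗc[k] B)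
    (D : Subcoalgebra k A) : Subcoalgebra k B where
  toSubmodule := D.toSubmodule.map φ.toLinearMap
  comul_mem := by
    rintro _ ⟨x, hx, rfl⟩
    obtain ⟨w, hw⟩ := D.comul_mem x hx
    have h := LinearMap.congr_fun φ.map_comp_comul x
    simp only [LinearMap.comp_apply] at h
    rw [← h, ← hw]
    clear h hw
    induction w with
    | zero => simp
    | add x y hx hy => simp only [map_add]; exact Submodule.add_mem _ hx hy
    | tmul x y =>
      exact ⟨⟨_, x, x.2, rfl⟩ ⊗ₜ ⟨_, y, y.2, rfl⟩, rfl⟩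

/-- `I` is a right coideal of `C`: a subspace `I ⊆ C` with `Δ(I) ⊆ I ⊗ C`. -/
def IsRightCoideal (C : Subcoalgebra k A) (I : Submodule k A) : Prop :=
  I ≤ C.toSubmodule ∧ ∀ x ∈ I, Coalgebra.comul (R := k) x ∈ tensorSub I C.toSubmodule

/-- The right coideal of `C` generated by `x`: the smallest one containing `x`. -/
def rightCoidealSpan (C : Subcoalgebra k A) (x : A) : Submodule k A :=
  sInf {I | C.IsRightCoideal I ∧ x ∈ I}

end Subcoalgebra

end Coalgebras

/-! ### Comodules, generators, and the left f-qcF property -/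

section Comodules

variable (k A : Type u) [Field k] [AddCommGroup A] [Module k A] [Coalgebra k A]

/-- Left comodules over the coalgebra `A`. -/
structure LeftComodule where
  carrier : Type u
  [addCommGroup : AddCommGroup carrier]
  [module : Module k carrier]
  coact : carrier →ₗ[k] A ⊗[k] carrier
  coassoc : ∀ m, TensorProduct.assoc k A A carrier
    ((Coalgebra.comul (R := k)).rTensor carrier (coact m)) = coact.lTensor A (coact m)
  counit : ∀ m, TensorProduct.lid k carrier
    ((Coalgebra.counit (R := k) (A := A)).rTensor carrier (coact m)) = m

attribute [instance] LeftComodule.addCommGroup LeftComodule.module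

namespace LeftComodule

variable {k A}

/-- Morphisms of left comodules: linear maps commuting with the coactions. -/
@[ext] structure Hom (M N : LeftComodule k A) where
  toLinearMap : M.carrier →ₗ[k] N.carrier
  comm : ∀ m, N.coact (toLinearMap m) = toLinearMap.lTensor A (M.coact m)

/-- The category of left comodules over `A`. -/
instance : Category (LeftComodule k A) where
  Hom M N := Hom M N
  id M := ⟨LinearMap.id, by simp⟩
  comp f g := ⟨g.toLinearMap ∘ₗ f.toLinearMap, fun m => by
    rw [LinearMap.comp_apply, g.comm, f.comm, LinearMap.lTensor_comp, LinearMap.comp_apply]⟩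

variable (k A) in
/-- The coalgebra `A` as a left comodule over itself. -/
def regular : LeftComodule k A where
  carrier := A
  coact := Coalgebra.comul
  coassoc := Coalgebra.coassoc_apply
  counit m := by rw [Coalgebra.rTensor_counit_comul]; simp

end LeftComodule

/-- `G` is a generator: every object `X` receives an epimorphism from a coproduct of
copies of `G`. -/
def IsGenerator {𝒞 : Type*} [Category.{u} 𝒞] (G : 𝒞) : Prop :=
  ∀ X : 𝒞, ∃ (ι : Type u) (c : Limits.Cofan (fun _ : ι => G)),
    Nonempty (Limits.IsColimit c) ∧ ∃ φ : c.pt ⟶ X, Epi φ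

/-- Right comodules over the coalgebra `A`. -/
structure RightComodule where
  carrier : Type u
  [addCommGroup : AddCommGroup carrier]
  [module : Module k carrier]
  coact : carrier →ₗ[k] carrier ⊗[k] A
  coassoc : ∀ m, TensorProduct.assoc k carrier A A (coact.rTensor A (coact m)) =
    (Coalgebra.comul (R := k)).lTensor carrier (coact m)
  counit : ∀ m, TensorProduct.rid k carrier
    ((Coalgebra.counit (R := k) (A := A)).lTensor carrier (coact m)) = m

attribute [instance] RightComodule.addCommGroup RightComodule.module

variable {k A} in
/-- The left action of the dual algebra on a right comodule, `f ⇀ m = ∑ m₀ f(m₁)`. -/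
noncomputable def RightComodule.act (M : RightComodule k A) (f : A →ₗ[k] k) (m : M.carrier) :
    M.carrier :=
  TensorProduct.rid k M.carrier (f.lTensor M.carrier (M.coact m))

/-- `A` is left f-qcF: every finite dimensional right comodule embeds, as a left module over the
dual algebra `A*` (with the convolution product), in a free left `A*`-module. -/
def IsLeftFQcF : Prop :=
  ∀ M : RightComodule k A, FiniteDimensional k M.carrier →
    ∃ (ι : Type u) (j : M.carrier →ₗ[k] (ι →₀ WithConv (A →ₗ[k] k))), Function.Injective j ∧
      ∀ (f : WithConv (A →ₗ[k] k)) (m : M.carrier), j (M.act f.ofConv m) = f • j m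

end Comodules

/-! ### Path coalgebras -/

section PathCoalgebras

/-- All paths of a quiver, trivial ones included. -/
abbrev TotalPath (V : Type u) [Quiver.{u} V] : Type u := Σ a b : V, Quiver.Path a b

/-- All factorisations `p = xy` of a path `p` (see `mem_splits` and `nodup_splits`). -/
def splits {V : Type u} [Quiver.{u} V] {a : V} :
    {b : V} → Quiver.Path a b → List (Σ c : V, Quiver.Path a c × Quiver.Path c b)
  | _, .nil => [⟨a, .nil, .nil⟩]
  | _, .cons p e => ⟨_, p.cons e, .nil⟩ :: (splits p).map fun z => ⟨z.1, z.2.1, z.2.2.cons e⟩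

theorem mem_splits {V : Type u} [Quiver.{u} V] {a b c : V} (p : Quiver.Path a b)
    (x : Quiver.Path a c) (y : Quiver.Path c b) : ⟨c, x, y⟩ ∈ splits p ↔ x.comp y = p := by
  induction p generalizing c with
  | nil =>
    cases y with
    | nil => simp [splits]
    | cons y e =>
      simp only [splits, List.mem_singleton, Quiver.Path.comp_cons]
      constructor
      · intro h
        have h1 := congrArg (fun z : (Σ c : V, Quiver.Path a c × Quiver.Path c a) =>
          z.2.2.length) h
        simp at h1
      · intro h; exact absurd h (Quiver.Path.cons_ne_nil _ _)
  | cons p e ih =>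
    cases y with
    | nil =>
      simp only [splits, List.mem_cons, List.mem_map, Quiver.Path.comp_nil]
      constructor
      · rintro (h | ⟨z, -, h⟩)
        · simpa using h
        · obtain ⟨d, x', y'⟩ := z
          have h1 := congrArg (fun z : (Σ c : V, Quiver.Path a c × Quiver.Path c _) =>
            z.2.2.length) h
          simp at h1
      · rintro rfl; exact Or.inl rfl
    | cons y e' =>
      simp only [splits, List.mem_cons, List.mem_map, Quiver.Path.comp_cons]
      constructor
      · rintro (h | ⟨z, hz, h⟩)
        · have h1 := congrArg (fun z : (Σ c : V, Quiver.Path a c × Quiver.Path c _) =>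
            z.2.2.length) h
          simp at h1
        · obtain ⟨d, x', y'⟩ := z
          rw [ih] at hz
          cases h
          rw [hz]
      · intro h
        cases h
        exact Or.inr ⟨⟨c, x, y⟩, (ih x y).2 rfl, rfl⟩

theorem nodup_splits {V : Type u} [Quiver.{u} V] {a b : V} (p : Quiver.Path a b) :
    (splits p).Nodup := by
  induction p with
  | nil => simp [splits]
  | cons p e ih =>
    simp only [splits, List.nodup_cons, List.mem_map, not_exists, not_and]
    constructor
    · rintro ⟨d, x', y'⟩ - h
      have h1 := congrArg (fun z : (Σ c : V, Quiver.Path a c × Quiver.Path c _) =>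
        z.2.2.length) h
      simp at h1
    · refine ih.map ?_
      rintro ⟨c, x, y⟩ ⟨c', x', y'⟩ h
      cases h
      rfl

/-- `∑_{xy = p} g(x, y)`. -/
def splitSum {V : Type u} [Quiver.{u} V] {M : Type u} [AddCommMonoid M] {a b : V}
    (p : Quiver.Path a b) (g : ∀ c : V, Quiver.Path a c → Quiver.Path c b → M) : M :=
  ((splits p).map fun z => g z.1 z.2.1 z.2.2).sum

section splitSum

variable {V : Type u} [Quiver.{u} V] {M : Type u} [AddCommMonoid M] {a : V}

theorem splitSum_nil (g : ∀ c : V, Quiver.Path a c → Quiver.Path c a → M) :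
    splitSum (.nil : Quiver.Path a a) g = g a .nil .nil := by simp [splitSum, splits]

theorem splitSum_cons {b b' : V} (p : Quiver.Path a b) (e : b ⟶ b')
    (g : ∀ c : V, Quiver.Path a c → Quiver.Path c b' → M) :
    splitSum (p.cons e) g = g b' (p.cons e) .nil + splitSum p fun c x y => g c x (y.cons e) := by
  simp [splitSum, splits, Function.comp_def]

theorem splitSum_add {b : V} (p : Quiver.Path a b)
    (g h : ∀ c : V, Quiver.Path a c → Quiver.Path c b → M) :
    splitSum p (fun c x y => g c x y + h c x y) = splitSum p g + splitSum p h := by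
  simp [splitSum, List.sum_map_add]

theorem map_splitSum {N F : Type u} [AddCommMonoid N] [FunLike F M N] [AddMonoidHomClass F M N]
    (φ : F) {b : V} (p : Quiver.Path a b)
    (g : ∀ c : V, Quiver.Path a c → Quiver.Path c b → M) :
    φ (splitSum p g) = splitSum p fun c x y => φ (g c x y) := by
  simp [splitSum, map_list_sum, Function.comp_def]

theorem splitSum_assoc {b : V} (p : Quiver.Path a b)
    (g : ∀ c d : V, Quiver.Path a c → Quiver.Path c d → Quiver.Path d b → M) :
    splitSum p (fun d x z => splitSum x fun c x y => g c d x y z) =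
      splitSum p fun c x y => splitSum y fun d y z => g c d x y z := by
  induction p with
  | nil => simp [splitSum_nil]
  | cons p e ih =>
    simp only [splitSum_cons, splitSum_nil, splitSum_add]
    rw [ih, add_assoc]

theorem splitSum_mapPath {W : Type u} [Quiver.{u} W] (F : V ⥤q W) {b : V} (p : Quiver.Path a b)
    (g : ∀ c : W, Quiver.Path (F.obj a) c → Quiver.Path c (F.obj b) → M) :
    splitSum (F.mapPath p) g =
      splitSum p fun c x y => g (F.obj c) (F.mapPath x) (F.mapPath y) := by
  induction p with
  | nil => simp [splitSum_nil]
  | cons p e ih =>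
    rw [Prefunctor.mapPath_cons, splitSum_cons, splitSum_cons, ih]
    rfl

end splitSum

variable (k : Type u) [Field k] (V : Type u) [Quiver.{u} V]

/-- The path coalgebra `kQ`: the vector space with basis the paths of the quiver. -/
def PathCoalgebra : Type u := TotalPath V →₀ k

noncomputable instance : AddCommGroup (PathCoalgebra k V) :=
  inferInstanceAs (AddCommGroup (TotalPath V →₀ k))

noncomputable instance : Module k (PathCoalgebra k V) :=
  inferInstanceAs (Module k (TotalPath V →₀ k))

namespace PathCoalgebra

variable {V}

/-- The basis element given by a path. -/
noncomputable def of {a b : V} (p : Quiver.Path a b) : PathCoalgebra k V :=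
  Finsupp.single (⟨a, b, p⟩ : TotalPath V) 1

/-- Linear extension of a map defined on paths. -/
noncomputable def lift {M : Type u} [AddCommGroup M] [Module k M]
    (g : ∀ a b : V, Quiver.Path a b → M) : PathCoalgebra k V →ₗ[k] M :=
  Finsupp.linearCombination k (fun p : TotalPath V => g p.1 p.2.1 p.2.2)

theorem lift_of {M : Type u} [AddCommGroup M] [Module k M]
    (g : ∀ a b : V, Quiver.Path a b → M) {a b : V} (p : Quiver.Path a b) :
    lift k g (of k p) = g a b p :=
  (Finsupp.linearCombination_single k (1 : k) (⟨a, b, p⟩ : TotalPath V)).trans (one_smul _ _)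

theorem ext_of {M : Type u} [AddCommGroup M] [Module k M]
    {f g : PathCoalgebra k V →ₗ[k] M}
    (h : ∀ (a b : V) (p : Quiver.Path a b), f (of k p) = g (of k p)) : f = g :=
  Finsupp.lhom_ext' fun p => LinearMap.ext_ring (h p.1 p.2.1 p.2.2)

/-- `Δ(p) = ∑_{xy = p} x ⊗ y`. -/
noncomputable def comulMap :
    PathCoalgebra k V →ₗ[k] PathCoalgebra k V ⊗[k] PathCoalgebra k V :=
  lift k fun _ _ p => splitSum p fun _ x y => of k x ⊗ₜ of k y

/-- `ε(p) = 1` if `p` is a trivial path, and `0` if not. -/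
noncomputable def counitMap : PathCoalgebra k V →ₗ[k] k :=
  lift k fun _ _ p => if p.length = 0 then 1 else 0

theorem splitSum_counit_left {M : Type u} [AddCommGroup M] [Module k M] {a b : V}
    (p : Quiver.Path a b) (g : ∀ c : V, Quiver.Path c b → M) :
    splitSum p (fun c x y => counitMap k (of k x) • g c y) = g a p := by
  induction p with
  | nil => simp [splitSum_nil, counitMap, lift_of]
  | cons p e ih =>
    rw [splitSum_cons, ih fun c y => g c (y.cons e)]
    simp [counitMap, lift_of]

theorem splitSum_counit_right {M : Type u} [AddCommGroup M] [Module k M] {a b : V}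
    (p : Quiver.Path a b) (g : ∀ c : V, Quiver.Path a c → M) :
    splitSum p (fun c x y => counitMap k (of k y) • g c x) = g b p := by
  cases p with
  | nil => simp [splitSum_nil, counitMap, lift_of]
  | cons p e =>
    rw [splitSum_cons]
    simp [counitMap, lift_of, splitSum]

/-- The path coalgebra. -/
noncomputable instance : Coalgebra k (PathCoalgebra k V) where
  comul := comulMap k
  counit := counitMap k
  coassoc := by
    apply ext_of
    intro a b p
    have h := splitSum_assoc p fun _ _ x y z => of k x ⊗ₜ[k] (of k y ⊗ₜ[k] of k z)
    simp only [LinearMap.comp_apply, comulMap, lift_of, LinearEquiv.coe_coe, map_splitSum,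
      LinearMap.rTensor_tmul, LinearMap.lTensor_tmul]
    convert h using 2
    · ext c x y
      have := map_splitSum (((TensorProduct.mk k
        (PathCoalgebra k V ⊗[k] PathCoalgebra k V) (PathCoalgebra k V)).flip (of k y))) x
        fun _ x y => of k x ⊗ₜ[k] of k y
      simp only [LinearMap.flip_apply, TensorProduct.mk_apply] at this
      rw [this, map_splitSum]
      simp
    · ext c x y
      exact map_splitSum (TensorProduct.mk k
        (PathCoalgebra k V) (PathCoalgebra k V ⊗[k] PathCoalgebra k V) (of k x)) y
        fun _ x y => of k x ⊗ₜ[k] of k y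
  rTensor_counit_comp_comul := by
    apply ext_of
    intro a b p
    have h := splitSum_counit_left k p fun c y => (1 : k) ⊗ₜ[k] of k y
    simp only [LinearMap.comp_apply, comulMap, lift_of, map_splitSum, LinearMap.rTensor_tmul,
      TensorProduct.mk_apply]
    rw [← h]
    congr 1
    ext c x y
    rw [TensorProduct.smul_tmul', smul_eq_mul, mul_one]
  lTensor_counit_comp_comul := by
    apply ext_of
    intro a b p
    have h := splitSum_counit_right k p fun c x => of k x ⊗ₜ[k] (1 : k)
    simp only [LinearMap.comp_apply, comulMap, lift_of, map_splitSum, LinearMap.lTensor_tmul,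
      TensorProduct.mk_apply, LinearMap.flip_apply]
    rw [← h]
    congr 1
    ext c x y
    rw [← TensorProduct.tmul_smul, smul_eq_mul, mul_one]

/-- The morphism of path coalgebras induced by a morphism of quivers. -/
noncomputable def mapQuiver {W : Type u} [Quiver.{u} W] (F : V ⥤q W) :
    PathCoalgebra k V →ₗc[k] PathCoalgebra k W where
  toLinearMap := lift k fun _ _ p => of k (F.mapPath p)
  counit_comp := by
    apply ext_of
    intro a b p
    have : (F.mapPath p).length = p.length := by
      induction p with
      | nil => rfl
      | cons p e ih => simp [ih]
    change counitMap k (lift k _ (of k p)) = counitMap k (of k p)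
    rw [lift_of]
    simp [counitMap, lift_of, this]
  map_comp_comul := by
    apply ext_of
    intro a b p
    change TensorProduct.map _ _ (comulMap k (of k p)) = comulMap k (lift k _ (of k p))
    rw [lift_of]
    simp only [comulMap, lift_of, map_splitSum, TensorProduct.map_tmul]
    rw [splitSum_mapPath]

/-- The linear combination of paths `p` ends at `b`: all paths in it have target `b`. -/
def EndsAt {k : Type u} [Field k] (p : PathCoalgebra k V) (b : V) : Prop :=
  ∀ x ∈ Finsupp.support p, x.2.1 = b

/-- The linear combination of paths `p` starts at `a`: all paths in it have source `a`. -/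
def StartsAt {k : Type u} [Field k] (p : PathCoalgebra k V) (a : V) : Prop :=
  ∀ x ∈ Finsupp.support p, x.1 = a

/-- A multipath: a linear combination of paths sharing the source and the target. -/
def IsMultipath {k : Type u} [Field k] (p : PathCoalgebra k V) : Prop :=
  (∃ a, StartsAt p a) ∧ ∃ b, EndsAt p b

end PathCoalgebra

/-- An admissible subcoalgebra contains all vertices and all arrows. -/
def IsAdmissible {k V : Type u} [Field k] [Quiver.{u} V]
    (C : Subcoalgebra k (PathCoalgebra k V)) : Prop :=
  (∀ v : V, PathCoalgebra.of k (.nil : Quiver.Path v v) ∈ C.toSubmodule) ∧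
    ∀ (v w : V) (e : v ⟶ w), PathCoalgebra.of k e.toPath ∈ C.toSubmodule

end PathCoalgebras

/-! ### The tail closure -/

section TailClosure

open PathCoalgebra

variable {k V : Type u} [Field k] [Quiver.{u} V]

/-- The finite independent sets of multipaths in `C`: finite linearly independent sets `F` of
multipaths in `C` such that for each `x ∈ F` the right coideal generated by `x` meets `F` only
in `x`. -/
def IndepSet (C : Subcoalgebra k (PathCoalgebra k V)) : Type u :=
  {F : Finset (PathCoalgebra k V) //
    (∀ p ∈ F, p ∈ C.toSubmodule ∧ IsMultipath p) ∧
    LinearIndepOn k id (F : Set (PathCoalgebra k V)) ∧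
    ∀ x ∈ F, (C.rightCoidealSpan x : Set (PathCoalgebra k V)) ∩ F = {x}}

/-- The vertices of the extended quiver: the old ones, and a vertex `e_F` for each finite
independent set `F` of multipaths in `C`. -/
inductive BarVertex (C : Subcoalgebra k (PathCoalgebra k V)) : Type u
  | old : V → BarVertex C
  | tail : IndepSet C → BarVertex C

/-- The arrows of the extended quiver: the old ones, and for each `p ∈ F` ending at `v` an arrow
from `v` to `e_F`. (The elements of `F` are nonzero, so `v` is determined by `p`.) -/
def BarVertex.Hom (C : Subcoalgebra k (PathCoalgebra k V)) : BarVertex C → BarVertex C → Type u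
  | .old v, .old w => v ⟶ w
  | .old v, .tail F => {p : PathCoalgebra k V // p ∈ F.1 ∧ EndsAt p v}
  | .tail _, _ => PEmpty

instance (C : Subcoalgebra k (PathCoalgebra k V)) : Quiver.{u} (BarVertex C) := ⟨BarVertex.Hom C⟩

/-- The inclusion of the quiver into the extended quiver. -/
def barInclusion (C : Subcoalgebra k (PathCoalgebra k V)) : V ⥤q BarVertex C where
  obj := .old
  map f := f

theorem IndepSet.endsAt {C : Subcoalgebra k (PathCoalgebra k V)} (F : IndepSet C)
    {p : PathCoalgebra k V} (hp : p ∈ F.1) {x : TotalPath V} (hx : x ∈ Finsupp.support p) :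
    EndsAt p x.2.1 := by
  obtain ⟨b, hb⟩ := (F.2.1 p hp).2.2
  rwa [hb x hx]

/-- The arrow `α_{p,F}` from the target of `p ∈ F`, which is the target of each path `x`
occurring in `p`, to `e_F`. -/
def tailArrow {C : Subcoalgebra k (PathCoalgebra k V)} (F : IndepSet C)
    {p : PathCoalgebra k V} (hp : p ∈ F.1) {x : TotalPath V} (hx : x ∈ Finsupp.support p) :
    BarVertex.old (C := C) x.2.1 ⟶ BarVertex.tail F :=
  (⟨p, hp, F.endsAt hp hx⟩ : {p : PathCoalgebra k V // p ∈ F.1 ∧ EndsAt p x.2.1})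

/-- `q_F = ∑_{p ∈ F} p α_{p,F}`, where `p α_{p,F} = ∑_x p(x) x α_{p,F}`, the sum being over the
paths `x` occurring in `p`. -/
noncomputable def tailElement {C : Subcoalgebra k (PathCoalgebra k V)} (F : IndepSet C) :
    PathCoalgebra k (BarVertex C) :=
  ∑ p : {p // p ∈ F.1}, ∑ x : {x // x ∈ Finsupp.support p.1},
    Finsupp.toFun p.1 x.1 •
      of k (((barInclusion C).mapPath x.1.2.2).cons (tailArrow F p.2 x.2))

/-- The subcoalgebra of the path coalgebra of the extended quiver generated by `C` and all `q_F`. -/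
noncomputable def bar (C : Subcoalgebra k (PathCoalgebra k V)) :
    Subcoalgebra k (PathCoalgebra k (BarVertex C)) :=
  Subcoalgebra.generated
    ((mapQuiver k (barInclusion C) '' C.toSubmodule) ∪ Set.range (tailElement (C := C)))

/-- A quiver together with a subcoalgebra of its path coalgebra. -/
structure Stage (k : Type u) [Field k] where
  V : Type u
  [quiver : Quiver.{u} V]
  C : Subcoalgebra k (PathCoalgebra k V)

attribute [instance] Stage.quiver

/-- The quivers `T^n(Q)` and the coalgebras `T^n(C)`. -/
noncomputable def stage (C : Subcoalgebra k (PathCoalgebra k V)) : ℕ → Stage k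
  | 0 => ⟨V, C⟩
  | n + 1 => ⟨BarVertex (stage C n).C, bar (stage C n).C⟩

/-- The vertices of the union `T(Q)` of the quivers `T^n(Q)`: those of `Q`, and the vertices
`e_F` added at the step from `T^n(Q)` to `T^{n+1}(Q)`, for each `n`. -/
inductive UnionVertex (C : Subcoalgebra k (PathCoalgebra k V)) : Type u
  | base : V → UnionVertex C
  | tail : (n : ℕ) → IndepSet (stage C n).C → UnionVertex C

/-- The inclusion of the vertices of `T^n(Q)` in those of `T(Q)`. -/
noncomputable def toUnionObj (C : Subcoalgebra k (PathCoalgebra k V)) :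
    (n : ℕ) → (stage C n).V → UnionVertex C
  | 0 => fun v : V => .base v
  | n + 1 => fun v : BarVertex (stage C n).C => match v with
    | .old w => toUnionObj C n w
    | .tail F => .tail n F

/-- The arrows of `T(Q)`: those of `Q`, and for each `p ∈ F` ending at a vertex `w` of `T^n(Q)`
an arrow from `w` to the vertex `e_F` added at the step from `T^n(Q)` to `T^{n+1}(Q)`. -/
def UnionVertex.Hom (C : Subcoalgebra k (PathCoalgebra k V)) (x y : UnionVertex C) : Type u :=
  match y with
  | .base w => match x with
    | .base v => v ⟶ w
    | .tail _ _ => PEmpty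
  | .tail n F =>
    {p : PathCoalgebra k (stage C n).V // p ∈ F.1 ∧ ∃ w, EndsAt p w ∧ toUnionObj C n w = x}

instance (C : Subcoalgebra k (PathCoalgebra k V)) : Quiver.{u} (UnionVertex C) :=
  ⟨UnionVertex.Hom C⟩

/-- The inclusion of the arrows of `T^n(Q)` in those of `T(Q)`. -/
noncomputable def toUnionMap (C : Subcoalgebra k (PathCoalgebra k V)) :
    (n : ℕ) → {v w : (stage C n).V} → (v ⟶ w) → (toUnionObj C n v ⟶ toUnionObj C n w)
  | 0, _, _, f => f
  | n + 1, v, w, f =>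
    match (v : BarVertex (stage C n).C), (w : BarVertex (stage C n).C), f with
    | .old _, .old _, f => toUnionMap C n f
    | .old v, .tail _, f => ⟨f.1, f.2.1, v, f.2.2, rfl⟩

/-- The inclusion of `T^n(Q)` in `T(Q)`. -/
noncomputable def toUnion (C : Subcoalgebra k (PathCoalgebra k V)) (n : ℕ) :
    (stage C n).V ⥤q UnionVertex C where
  obj := toUnionObj C n
  map := toUnionMap C n

/-- The tail closure `T(C)`, the union of the `T^n(C)` inside the path coalgebra of `T(Q)`. -/
noncomputable def tailClosure (C : Subcoalgebra k (PathCoalgebra k V)) :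
    Subcoalgebra k (PathCoalgebra k (UnionVertex C)) :=
  Subcoalgebra.iSup fun n => (stage C n).C.map (mapQuiver k (toUnion C n))

end TailClosure

/-! Write `A` for the tail closure and let functionals act on it by `f ⇀ x = ∑ x₁ f(x₂)` (`hit`) and
`x ↼ f = ∑ f(x₁) x₂` (`coHit`). Both claims follow from one fact, `HasTails.exists_embedding`: every
finite dimensional subspace of `A` is mapped injectively to `A*` by a linear map `g` with `g(f ⇀ x)
= f * g(x)`.

The map comes from the tails. A finite dimensional subspace lies in some stage, and there in the
right coideal `∑ A* ⇀ p` generated by a finite independent set `F` of multipaths: a generating set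
of multipaths of least cardinality is independent (`exists_indepSet`). Let `ρ_p` be the functional
dual to the arrow `α_{p,F}`. Then `ρ_p ⇀ q_F = p`, and for each `d` in `A` there is one functional
`a` with `ρ_p ⇀ d = p ↼ a` for all `p ∈ F` (`stageMap_mem_tailSubmodule`). The reason is that the
arrows `α_{p,F}` enter `A` only through elements `q_F ↼ f`, on which `ρ_p` acts with value `p ↼ f`.

Put `g(∑ f_p ⇀ p) = ∑ f_p * ρ_p`. At `d` the right side is `∑ f_p(p ↼ a) = a(∑ f_p ⇀ p)`, so `g` is
well defined; and `g(x) ⇀ q_F = x`, so it is injective. `HasTails` records exactly what this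
argument uses.

For f-qcF, a finite dimensional right comodule embeds in a power of `A` by its coefficient maps, and
`g` carries the coefficients to `A*`. For the generator property, `g` applied to the coefficients of
an element of a left comodule gives a morphism from `A`, and injectivity of `g` makes the images of
such morphisms span. -/

/-! ### The actions of functionals on comodules and coalgebras -/

section Contractions

variable {k A : Type u} [Field k] [AddCommGroup A] [Module k A]

/-- Contraction of the right factor of a tensor with a functional. -/
noncomputable def sliceRight (M : Type u) [AddCommGroup M] [Module k M] (f : A →ₗ[k] k) :
    M ⊗[k] A →ₗ[k] M :=
  (TensorProduct.rid k M).toLinearMap ∘ₗ f.lTensor M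

/-- Contraction of the left factor of a tensor with a functional. -/
noncomputable def sliceLeft (M : Type u) [AddCommGroup M] [Module k M] (f : A →ₗ[k] k) :
    A ⊗[k] M →ₗ[k] M :=
  (TensorProduct.lid k M).toLinearMap ∘ₗ f.rTensor M

section
variable {M N : Type u} [AddCommGroup M] [Module k M] [AddCommGroup N] [Module k N]

@[simp] theorem sliceRight_tmul (f : A →ₗ[k] k) (m : M) (a : A) :
    sliceRight M f (m ⊗ₜ a) = f a • m := by simp [sliceRight]

@[simp] theorem sliceLeft_tmul (f : A →ₗ[k] k) (m : M) (a : A) :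
    sliceLeft M f (a ⊗ₜ m) = f a • m := by simp [sliceLeft]

theorem sliceRight_add (f g : A →ₗ[k] k) (z : M ⊗[k] A) :
    sliceRight M (f + g) z = sliceRight M f z + sliceRight M g z := by
  simp [sliceRight, LinearMap.lTensor_add]

theorem sliceRight_smul (c : k) (f : A →ₗ[k] k) (z : M ⊗[k] A) :
    sliceRight M (c • f) z = c • sliceRight M f z := by
  simp [sliceRight, LinearMap.lTensor_smul]

theorem sliceLeft_add (f g : A →ₗ[k] k) (z : A ⊗[k] M) :
    sliceLeft M (f + g) z = sliceLeft M f z + sliceLeft M g z := by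
  simp [sliceLeft, LinearMap.rTensor_add]

theorem sliceLeft_smul (c : k) (f : A →ₗ[k] k) (z : A ⊗[k] M) :
    sliceLeft M (c • f) z = c • sliceLeft M f z := by
  simp [sliceLeft, LinearMap.rTensor_smul]

theorem apply_sliceRight (f : A →ₗ[k] k) (g : M →ₗ[k] k) (z : M ⊗[k] A) :
    g (sliceRight M f z) = f (sliceLeft A g z) := by
  induction z with
  | zero => simp
  | add x y hx hy => simp only [map_add, hx, hy]
  | tmul x y => simp [mul_comm]

theorem sliceRight_rTensor (f : A →ₗ[k] k) (φ : M →ₗ[k] N) (z : M ⊗[k] A) :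
    sliceRight N f (φ.rTensor A z) = φ (sliceRight M f z) := by
  induction z with
  | zero => simp
  | add x y hx hy => simp only [map_add, hx, hy]
  | tmul x y => simp

theorem sliceLeft_lTensor (f : A →ₗ[k] k) (φ : M →ₗ[k] N) (z : A ⊗[k] M) :
    sliceLeft N f (φ.lTensor A z) = φ (sliceLeft M f z) := by
  induction z with
  | zero => simp
  | add x y hx hy => simp only [map_add, hx, hy]
  | tmul x y => simp

theorem sliceRight_lTensor {B : Type u} [AddCommGroup B] [Module k B]
    (f : B →ₗ[k] k) (φ : A →ₗ[k] B) (z : M ⊗[k] A) :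
    sliceRight M f (φ.lTensor M z) = sliceRight M (f ∘ₗ φ) z := by
  induction z with
  | zero => simp
  | add x y hx hy => simp only [map_add, hx, hy]
  | tmul x y => simp

theorem sliceLeft_rTensor {B : Type u} [AddCommGroup B] [Module k B]
    (f : B →ₗ[k] k) (φ : A →ₗ[k] B) (z : A ⊗[k] M) :
    sliceLeft M f (φ.rTensor M z) = sliceLeft M (f ∘ₗ φ) z := by
  induction z with
  | zero => simp
  | add x y hx hy => simp only [map_add, hx, hy]
  | tmul x y => simp

theorem sliceRight_ext {z w : M ⊗[k] A}
    (h : ∀ f : A →ₗ[k] k, sliceRight M f z = sliceRight M f w) : z = w := by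
  rw [← sub_eq_zero]
  refine tensor_eq_zero_of_right _ fun f => ?_
  change sliceRight M f _ = 0
  rw [map_sub, h, sub_self]

theorem sliceLeft_ext {z w : A ⊗[k] M}
    (h : ∀ f : A →ₗ[k] k, sliceLeft M f z = sliceLeft M f w) : z = w := by
  rw [← sub_eq_zero]
  refine tensor_eq_zero_of_left _ fun f => ?_
  change sliceLeft M f _ = 0
  rw [map_sub, h, sub_self]

theorem sliceRight_sliceRight (ρ : M →ₗ[k] M ⊗[k] A) (f g : A →ₗ[k] k) (w : M ⊗[k] A) :
    sliceRight M f (ρ (sliceRight M g w)) =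
      sliceRight M (LinearMap.mul' k k ∘ₗ TensorProduct.map f g)
        (TensorProduct.assoc k M A A (ρ.rTensor A w)) := by
  induction w with
  | zero => simp
  | add x y hx hy => simp only [map_add, hx, hy]
  | tmul x y =>
    simp only [sliceRight_tmul, map_smul, LinearMap.rTensor_tmul]
    induction ρ x with
    | zero => simp
    | add x y hx hy => simp only [map_add, smul_add, add_tmul, hx, hy]
    | tmul x z => simp [smul_smul, mul_comm]

theorem sliceLeft_sliceLeft (ρ : M →ₗ[k] A ⊗[k] M) (f g : A →ₗ[k] k) (w : A ⊗[k] M) :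
    sliceLeft M g (ρ (sliceLeft M f w)) =
      sliceLeft M (LinearMap.mul' k k ∘ₗ TensorProduct.map f g)
        ((TensorProduct.assoc k A A M).symm (ρ.lTensor A w)) := by
  induction w with
  | zero => simp
  | add x y hx hy => simp only [map_add, hx, hy]
  | tmul x y =>
    simp only [sliceLeft_tmul, map_smul, LinearMap.lTensor_tmul]
    induction ρ y with
    | zero => simp
    | add x y hx hy => simp only [map_add, smul_add, tmul_add, hx, hy]
    | tmul x z => simp [smul_smul]

end

/-- A tensor is a finite sum of pure tensors, and all its slices lie in the span of their second
factors. This is the source of local finiteness of comodules. -/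
theorem finite_range_slice {X : Type u} [AddCommGroup X] [Module k X] (z : A ⊗[k] X) :
    ∃ W : Submodule k X, FiniteDimensional k W ∧ ∀ f, sliceLeft X f z ∈ W := by
  induction z with
  | zero => exact ⟨⊥, inferInstance, by simp⟩
  | add x y hx hy =>
    obtain ⟨W, _, hW⟩ := hx
    obtain ⟨W', _, hW'⟩ := hy
    refine ⟨W ⊔ W', inferInstance, fun f => ?_⟩
    rw [map_add]
    exact Submodule.add_mem_sup (hW f) (hW' f)
  | tmul a x =>
    refine ⟨k ∙ x, inferInstance, fun f => ?_⟩
    rw [sliceLeft_tmul]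
    exact Submodule.smul_mem _ _ (Submodule.mem_span_singleton_self x)

/-- Membership in `D ⊗ E` is tested by contracting with functionals. -/
theorem mem_tensorSub_of_contract {D E : Submodule k A} {z : A ⊗[k] A}
    (h1 : ∀ f : A →ₗ[k] k, sliceRight A f z ∈ D)
    (h2 : ∀ f : A →ₗ[k] k, sliceLeft A f z ∈ E) : z ∈ tensorSub D E := by
  -- Projections onto `D` and `E` fix all slices of `z`, hence fix `z` itself when applied to the
  -- corresponding factor.
  obtain ⟨g, hg⟩ := LinearMap.exists_leftInverse_of_injective D.subtype D.ker_subtype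
  obtain ⟨g', hg'⟩ := LinearMap.exists_leftInverse_of_injective E.subtype E.ker_subtype
  have hP : ∀ x ∈ D, (D.subtype ∘ₗ g) x = x := fun x hx =>
    congrArg Subtype.val (LinearMap.congr_fun hg ⟨x, hx⟩)
  have hP' : ∀ x ∈ E, (E.subtype ∘ₗ g') x = x := fun x hx =>
    congrArg Subtype.val (LinearMap.congr_fun hg' ⟨x, hx⟩)
  have e1 : (D.subtype ∘ₗ g).rTensor A z = z := sliceRight_ext fun f => by
    rw [sliceRight_rTensor, hP _ (h1 f)]
  have e2 : (E.subtype ∘ₗ g').lTensor A z = z := sliceLeft_ext fun f => by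
    rw [sliceLeft_lTensor, hP' _ (h2 f)]
  refine ⟨TensorProduct.map g g' z, ?_⟩
  rw [← LinearMap.comp_apply, ← TensorProduct.map_comp]
  conv_rhs => rw [← e2, ← e1]
  rw [← LinearMap.comp_apply, LinearMap.lTensor_comp_rTensor]

theorem contract_of_mem_tensorSub {D E : Submodule k A} {z : A ⊗[k] A} (h : z ∈ tensorSub D E)
    (f : A →ₗ[k] k) : sliceRight A f z ∈ D ∧ sliceLeft A f z ∈ E := by
  obtain ⟨w, rfl⟩ := h
  induction w with
  | zero => simp
  | add x y hx hy =>
    simp only [map_add]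
    exact ⟨D.add_mem hx.1 hy.1, E.add_mem hx.2 hy.2⟩
  | tmul x y =>
    simp only [map_tmul, Submodule.subtype_apply, sliceRight_tmul, sliceLeft_tmul]
    exact ⟨D.smul_mem _ x.2, E.smul_mem _ y.2⟩

variable [Coalgebra k A]

/-- The left action `f ⇀ x = ∑ x₁ f(x₂)` of a functional on a coalgebra. -/
noncomputable def hit (f : A →ₗ[k] k) : A →ₗ[k] A := sliceRight A f ∘ₗ Coalgebra.comul

/-- The right action `x ↼ f = ∑ f(x₁) x₂` of a functional on a coalgebra. -/
noncomputable def coHit (f : A →ₗ[k] k) : A →ₗ[k] A := sliceLeft A f ∘ₗ Coalgebra.comul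

theorem hit_apply (f : A →ₗ[k] k) (x : A) :
    hit f x = sliceRight A f (Coalgebra.comul (R := k) x) := rfl

theorem coHit_apply (f : A →ₗ[k] k) (x : A) :
    coHit f x = sliceLeft A f (Coalgebra.comul (R := k) x) := rfl

theorem hit_add (f g : A →ₗ[k] k) (x : A) : hit (f + g) x = hit f x + hit g x :=
  sliceRight_add f g _

theorem hit_smul (c : k) (f : A →ₗ[k] k) (x : A) : hit (c • f) x = c • hit f x :=
  sliceRight_smul c f _

theorem coHit_add (f g : A →ₗ[k] k) (x : A) : coHit (f + g) x = coHit f x + coHit g x :=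
  sliceLeft_add f g _

theorem coHit_smul (c : k) (f : A →ₗ[k] k) (x : A) : coHit (c • f) x = c • coHit f x :=
  sliceLeft_smul c f _

/-- The map `f ↦ f ⇀ x`. -/
noncomputable def hitOn (x : A) : (A →ₗ[k] k) →ₗ[k] A where
  toFun f := hit f x
  map_add' f g := hit_add f g x
  map_smul' c f := hit_smul c f x

theorem hitOn_apply (x : A) (f : A →ₗ[k] k) : hitOn x f = hit f x := rfl

@[simp] theorem hit_zero (x : A) : hit (0 : A →ₗ[k] k) x = 0 := by
  simpa using hit_smul (0 : k) 0 x

@[simp] theorem coHit_zero (x : A) : coHit (0 : A →ₗ[k] k) x = 0 := by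
  simpa using coHit_smul (0 : k) 0 x

/-- Both sides are `∑ g(x₁) f(x₂)`. This adjunction reduces statements about `coHit` to statements
about `hit`. -/
theorem apply_hit (f g : A →ₗ[k] k) (x : A) : g (hit f x) = f (coHit g x) :=
  apply_sliceRight f g _

@[simp] theorem hit_counit (x : A) : hit (Coalgebra.counit (R := k)) x = x := by
  simp [hit, sliceRight]

@[simp] theorem coHit_counit (x : A) : coHit (Coalgebra.counit (R := k)) x = x := by
  simp [coHit, sliceLeft]

theorem contract_comul (f g : A →ₗ[k] k) :
    (LinearMap.mul' k k ∘ₗ TensorProduct.map f g) ∘ₗ Coalgebra.comul = f ∘ₗ hit g := by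
  ext x
  simp only [LinearMap.comp_apply, hit_apply]
  induction Coalgebra.comul (R := k) x with
  | zero => simp
  | add x y hx hy => simp only [map_add, hx, hy]
  | tmul x y => simp [mul_comm]

/-- `f ∘ₗ hit g` is the convolution product `f * g`, so this is the module law, a form of
coassociativity. -/
theorem hit_hit (f g : A →ₗ[k] k) (x : A) : hit f (hit g x) = hit (f ∘ₗ hit g) x := by
  rw [hit_apply, hit_apply, sliceRight_sliceRight, Coalgebra.coassoc_apply,
    sliceRight_lTensor, contract_comul, hit_apply]

theorem eq_of_forall_functional {M : Type u} [AddCommGroup M] [Module k M] {x y : M}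
    (h : ∀ f : M →ₗ[k] k, f x = f y) : x = y := by
  rw [← sub_eq_zero, ← Module.forall_dual_apply_eq_zero_iff k]
  intro f
  rw [map_sub, h, sub_self]

/-- Both sides are `∑ g(x₁) f(x₃) x₂`; tested against a functional, the identity becomes
associativity of convolution. -/
theorem hit_coHit (f g : A →ₗ[k] k) (x : A) : hit f (coHit g x) = coHit g (hit f x) := by
  refine eq_of_forall_functional (k := k) fun h => ?_
  have e1 : h (hit f (coHit g x)) = g (hit h (hit f x)) := by
    rw [hit_hit]
    exact (apply_hit (h ∘ₗ hit f) g x).symm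
  rw [e1, apply_hit]

theorem coHit_coHit (f g : A →ₗ[k] k) (x : A) : coHit f (coHit g x) = coHit (g ∘ₗ hit f) x := by
  refine eq_of_forall_functional (k := k) fun h => ?_
  rw [← apply_hit, hit_coHit, ← apply_hit f g, ← apply_hit]
  rfl

theorem toConv_mul_apply (f g : A →ₗ[k] k) (x : A) :
    (WithConv.toConv f * WithConv.toConv g).ofConv x = f (hit g x) := by
  exact LinearMap.congr_fun (contract_comul f g) x

section Morphism

variable {B : Type u} [AddCommGroup B] [Module k B] [Coalgebra k B] (φ : A →ₗc[k] B)

theorem map_hit (g : B →ₗ[k] k) (x : A) :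
    φ (hit (g ∘ₗ φ.toLinearMap) x) = hit g (φ x) := by
  have h : TensorProduct.map φ.toLinearMap φ.toLinearMap (Coalgebra.comul (R := k) x) =
    Coalgebra.comul (R := k) (φ x) := LinearMap.congr_fun φ.map_comp_comul x
  rw [hit_apply, hit_apply, ← h, ← LinearMap.lTensor_comp_rTensor, LinearMap.comp_apply,
    sliceRight_lTensor, sliceRight_rTensor]
  rfl

theorem map_coHit (g : B →ₗ[k] k) (x : A) :
    φ (coHit (g ∘ₗ φ.toLinearMap) x) = coHit g (φ x) := by
  have h : TensorProduct.map φ.toLinearMap φ.toLinearMap (Coalgebra.comul (R := k) x) =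
    Coalgebra.comul (R := k) (φ x) := LinearMap.congr_fun φ.map_comp_comul x
  rw [coHit_apply, coHit_apply, ← h, ← LinearMap.rTensor_comp_lTensor, LinearMap.comp_apply,
    sliceLeft_rTensor, sliceLeft_lTensor]
  rfl

end Morphism

namespace Subcoalgebra

theorem hit_mem (D : Subcoalgebra k A) (f : A →ₗ[k] k) {x : A} (hx : x ∈ D.toSubmodule) :
    hit f x ∈ D.toSubmodule := (contract_of_mem_tensorSub (D.comul_mem x hx) f).1

theorem coHit_mem (D : Subcoalgebra k A) (f : A →ₗ[k] k) {x : A} (hx : x ∈ D.toSubmodule) :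
    coHit f x ∈ D.toSubmodule := (contract_of_mem_tensorSub (D.comul_mem x hx) f).2

/-- A subspace stable under both actions of functionals is a subcoalgebra. -/
def ofHit (D : Submodule k A) (h1 : ∀ f : A →ₗ[k] k, ∀ x ∈ D, hit f x ∈ D)
    (h2 : ∀ f : A →ₗ[k] k, ∀ x ∈ D, coHit f x ∈ D) : Subcoalgebra k A where
  toSubmodule := D
  comul_mem x hx := mem_tensorSub_of_contract (fun f => h1 f x hx) fun f => h2 f x hx

theorem generated_le {S : Set A} (E : Subcoalgebra k A) (h : S ⊆ E.toSubmodule) :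
    (generated (k := k) S).toSubmodule ≤ E.toSubmodule := sInf_le ⟨E, rfl, h⟩

theorem subset_generated (S : Set A) : S ⊆ (generated (k := k) S).toSubmodule := by
  intro x hx
  refine Submodule.mem_sInf.2 ?_
  rintro _ ⟨E, rfl, h⟩
  exact h hx

/-- The inclusion of a subcoalgebra as a morphism of coalgebras. -/
noncomputable def inclusion (D : Subcoalgebra k A) : D.toSubmodule →ₗc[k] A where
  toLinearMap := D.toSubmodule.subtype
  counit_comp := rfl
  map_comp_comul := LinearMap.ext D.map_comulAux

theorem coe_hit (D : Subcoalgebra k A) (f : A →ₗ[k] k) (x : D.toSubmodule) :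
    (hit (f ∘ₗ D.toSubmodule.subtype) x : A) = hit f (x : A) := map_hit D.inclusion f x

theorem coe_coHit (D : Subcoalgebra k A) (f : A →ₗ[k] k) (x : D.toSubmodule) :
    (coHit (f ∘ₗ D.toSubmodule.subtype) x : A) = coHit f (x : A) := map_coHit D.inclusion f x

/-- The subspace `{f ⇀ x}`. -/
noncomputable def hitRange (x : A) : Submodule k A := LinearMap.range (hitOn (k := k) x)

theorem self_mem_hitRange (x : A) : x ∈ hitRange (k := k) x := ⟨_, hit_counit x⟩

/-- The subspace `A* ⇀ x` is itself a right coideal of `D`: right slices of `Δ(f ⇀ x)` are again of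
the form `h ⇀ x`, and left slices stay in `D`. -/
theorem rightCoidealSpan_le_hitRange (D : Subcoalgebra k A) {x : A} (hx : x ∈ D.toSubmodule) :
    D.rightCoidealSpan x ≤ hitRange x := by
  refine sInf_le ⟨⟨?_, ?_⟩, self_mem_hitRange x⟩
  · rintro _ ⟨f, rfl⟩
    exact D.hit_mem f hx
  · rintro _ ⟨f, rfl⟩
    refine mem_tensorSub_of_contract (fun g => ⟨g ∘ₗ hit f, (hit_hit g f x).symm⟩) fun g => ?_
    exact D.coHit_mem g (D.hit_mem f hx)

theorem mem_rightCoidealSpan_self (D : Subcoalgebra k A) (x : A) : x ∈ D.rightCoidealSpan x :=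
  Submodule.mem_sInf.2 fun _ h => h.2

end Subcoalgebra

/-! ### Coefficient maps of comodules -/

/-- Contractions of the coaction of a right comodule in the module factor. -/
noncomputable def RightComodule.coeff (M : RightComodule k A) (a : M.carrier →ₗ[k] k) :
    M.carrier →ₗ[k] A := sliceLeft A a ∘ₗ M.coact

theorem RightComodule.act_act (M : RightComodule k A) (f g : A →ₗ[k] k) (m : M.carrier) :
    M.act f (M.act g m) = M.act (f ∘ₗ hit g) m := by
  change sliceRight M.carrier f (M.coact (sliceRight M.carrier g (M.coact m))) =
    sliceRight M.carrier _ (M.coact m)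
  rw [sliceRight_sliceRight, M.coassoc, sliceRight_lTensor, contract_comul]

theorem RightComodule.apply_act (M : RightComodule k A) (f : A →ₗ[k] k) (a : M.carrier →ₗ[k] k)
    (m : M.carrier) : a (M.act f m) = f (M.coeff a m) := apply_sliceRight f a _

theorem RightComodule.coeff_act (M : RightComodule k A) (f : A →ₗ[k] k) (a : M.carrier →ₗ[k] k)
    (m : M.carrier) : M.coeff a (M.act f m) = hit f (M.coeff a m) := by
  refine eq_of_forall_functional (k := k) fun g => ?_
  rw [← M.apply_act, M.act_act, M.apply_act]
  rfl

theorem RightComodule.counit_coeff (M : RightComodule k A) (a : M.carrier →ₗ[k] k)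
    (m : M.carrier) : Coalgebra.counit (R := k) (M.coeff a m) = a m := by
  rw [← M.apply_act]
  exact congrArg a (M.counit m)

/-- The right action of a functional on a left comodule. -/
noncomputable def LeftComodule.act (X : LeftComodule k A) (f : A →ₗ[k] k) :
    X.carrier →ₗ[k] X.carrier := sliceLeft X.carrier f ∘ₗ X.coact

/-- Contractions of the coaction of a left comodule in the module factor. -/
noncomputable def LeftComodule.coeff (X : LeftComodule k A) (a : X.carrier →ₗ[k] k) :
    X.carrier →ₗ[k] A := sliceRight A a ∘ₗ X.coact

theorem LeftComodule.act_act (X : LeftComodule k A) (f g : A →ₗ[k] k) (x : X.carrier) :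
    X.act g (X.act f x) = X.act (f ∘ₗ hit g) x := by
  change sliceLeft X.carrier g (X.coact (sliceLeft X.carrier f (X.coact x))) =
    sliceLeft X.carrier _ (X.coact x)
  rw [sliceLeft_sliceLeft, ← X.coassoc, LinearEquiv.symm_apply_apply, sliceLeft_rTensor,
    contract_comul]

theorem LeftComodule.apply_act (X : LeftComodule k A) (f : A →ₗ[k] k) (a : X.carrier →ₗ[k] k)
    (x : X.carrier) : a (X.act f x) = f (X.coeff a x) := (apply_sliceRight a f _).symm

theorem LeftComodule.act_counit (X : LeftComodule k A) (x : X.carrier) :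
    X.act Coalgebra.counit x = x := X.counit x

end Contractions

/-! ### A criterion for a coalgebra to be a generator and left f-qcF -/

section Criterion

variable (k A : Type u) [Field k] [AddCommGroup A] [Module k A] [Coalgebra k A]

/-- Every finite dimensional subspace is contained in a right coideal with finitely many generators
`P j`, for which there are functionals `ρ j` and an element `q` such that `ρ j ⇀ q = P j`, and such
that for each `d` the family `ρ j ⇀ d` is of the form `P j ↼ a`. -/
def HasTails : Prop :=
  ∀ M : Submodule k A, FiniteDimensional k M →
    ∃ (J : Type u) (_ : Fintype J) (P : J → A) (ρ : J → A →ₗ[k] k) (q : A),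
      (∀ x ∈ M, ∃ f : J → A →ₗ[k] k, ∑ j, hit (f j) (P j) = x) ∧
      (∀ j, hit (ρ j) q = P j) ∧ ∀ d, ∃ a : A →ₗ[k] k, ∀ j, hit (ρ j) d = coHit a (P j)

variable {k A}

/-- The map is forced on the range of `Ψ`; over a field it extends to all of `Y`. -/
theorem exists_comp_eq_of_ker_le {X Y Z : Type u} [AddCommGroup X] [Module k X] [AddCommGroup Y]
    [Module k Y] [AddCommGroup Z] [Module k Z] (Ψ : X →ₗ[k] Y) (Θ : X →ₗ[k] Z)
    (h : LinearMap.ker Ψ ≤ LinearMap.ker Θ) : ∃ g : Y →ₗ[k] Z, ∀ x, g (Ψ x) = Θ x := by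
  obtain ⟨g, hg⟩ := LinearMap.exists_extend
    ((LinearMap.ker Ψ).liftQ Θ h ∘ₗ Ψ.quotKerEquivRange.symm.toLinearMap)
  refine ⟨g, fun x => ?_⟩
  have h1 := LinearMap.congr_fun hg ⟨Ψ x, x, rfl⟩
  have h2 : Ψ.quotKerEquivRange.symm ⟨Ψ x, x, rfl⟩ = (LinearMap.ker Ψ).mkQ x := by
    rw [LinearEquiv.symm_apply_eq]
    rfl
  simp only [LinearMap.comp_apply, LinearEquiv.coe_coe, h2] at h1
  simpa using h1

/-- A finite dimensional subspace embeds in the dual algebra by a map which is linear over the dual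
algebra. -/
theorem HasTails.exists_embedding (h : HasTails k A) (M : Submodule k A)
    [hM : FiniteDimensional k M] :
    ∃ g : A →ₗ[k] (A →ₗ[k] k), (∀ x ∈ M, ∀ f, g (hit f x) = f ∘ₗ hit (g x)) ∧
      ∀ x ∈ M, g x = 0 → x = 0 := by
  obtain ⟨J, _, P, ρ, q, hP, hq, hd⟩ := h M hM
  -- `Ψ` parametrises the coideal by `f ↦ ∑ f_j ⇀ P_j`, and `Θ` is `f ↦ ∑ f_j * ρ_j`; the desired
  -- `g` is the factorisation of `Θ` through `Ψ`.
  let Ψ : (J → A →ₗ[k] k) →ₗ[k] A := ∑ j, hitOn (P j) ∘ₗ LinearMap.proj j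
  let Θ : (J → A →ₗ[k] k) →ₗ[k] (A →ₗ[k] k) := ∑ j, (hit (ρ j)).lcomp k k ∘ₗ LinearMap.proj j
  have hΨ : ∀ f, Ψ f = ∑ j, hit (f j) (P j) := fun f => by simp [Ψ, hitOn_apply]
  have hΘ : ∀ f, Θ f = ∑ j, f j ∘ₗ hit (ρ j) := fun f => by
    simp only [Θ, LinearMap.sum_apply]
    rfl
  obtain ⟨g, hg⟩ := exists_comp_eq_of_ker_le Ψ Θ (by
    intro f hf
    rw [LinearMap.mem_ker, hΨ] at hf
    rw [LinearMap.mem_ker, hΘ]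
    ext d
    -- Since the same `a` serves all `j`, the value of `Θ f` at `d` is `∑ f_j(P_j ↼ a) = a(Ψ f) =
    -- 0`.
    obtain ⟨a, ha⟩ := hd d
    simp only [LinearMap.sum_apply, LinearMap.comp_apply, ha, LinearMap.zero_apply, ← apply_hit]
    rw [← map_sum, hf, map_zero])
  refine ⟨g, fun x hx f => ?_, fun x hx hgx => ?_⟩
  · obtain ⟨c, rfl⟩ := hP x hx
    have e : hit f (∑ j, hit (c j) (P j)) = Ψ fun j => f ∘ₗ hit (c j) := by
      simp [hΨ, hit_hit]
    rw [e, ← hΨ, hg, hg, hΘ, hΘ]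
    ext d
    rw [LinearMap.comp_apply, ← hitOn_apply d]
    simp [hitOn_apply, hit_hit]
  · obtain ⟨c, rfl⟩ := hP x hx
    rw [← hΨ, hg, hΘ] at hgx
    -- Acting on `q` inverts `g`: `(∑ c_j * ρ_j) ⇀ q = ∑ c_j ⇀ P_j`.
    have e : hit (∑ j, c j ∘ₗ hit (ρ j)) q = ∑ j, hit (c j) (P j) := by
      rw [← hitOn_apply]
      simp [hitOn_apply, ← hit_hit, hq]
    rw [← e, hgx, hit_zero]

/-- The coefficient maps for a basis of `M*` are linear over the dual algebra and jointly injective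
by the counit. Their ranges span a finite dimensional subspace, on which `g` embeds into `A*`; the
free module has one copy of `A*` for each basis vector. -/
theorem HasTails.isLeftFQcF (h : HasTails k A) : IsLeftFQcF k A := by
  intro M hM
  let b := Module.Basis.ofVectorSpace k M.carrier
  have : Finite (Module.Basis.ofVectorSpaceIndex k M.carrier) := Module.Finite.finite_basis b
  obtain ⟨g, hg, hg0⟩ := h.exists_embedding (⨆ i, LinearMap.range (M.coeff (b.coord i)))
  have hmem : ∀ i m, M.coeff (b.coord i) m ∈ ⨆ i, LinearMap.range (M.coeff (b.coord i)) :=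
    fun i m => Submodule.mem_iSup_of_mem i ⟨m, rfl⟩
  let j : M.carrier →ₗ[k] (Module.Basis.ofVectorSpaceIndex k M.carrier →₀
      WithConv (A →ₗ[k] k)) :=
    (Finsupp.linearEquivFunOnFinite k _ _).symm.toLinearMap ∘ₗ LinearMap.pi fun i =>
      (WithConv.linearEquiv k (A →ₗ[k] k)).symm.toLinearMap ∘ₗ g ∘ₗ M.coeff (b.coord i)
  have hj : ∀ m i, j m i = WithConv.toConv (g (M.coeff (b.coord i) m)) := fun m i => rfl
  refine ⟨_, j, ?_, fun f m => ?_⟩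
  · rw [injective_iff_map_eq_zero]
    intro m hm
    refine b.ext_elem fun i => ?_
    have h1 : g (M.coeff (b.coord i) m) = 0 := by
      have := DFunLike.congr_fun hm i
      rw [hj] at this
      exact congrArg WithConv.ofConv this
    have h2 := M.counit_coeff (b.coord i) m
    rw [hg0 _ (hmem i m) h1, map_zero] at h2
    rw [← b.coord_apply, ← h2]
    simp
  · ext i : 1
    rw [hj, M.coeff_act, hg _ (hmem i m)]
    ext d
    rw [Finsupp.smul_apply, hj]
    exact (toConv_mul_apply f.ofConv (g (M.coeff (b.coord i) m)) d).symm

/-! ### Coproducts of copies of the regular comodule -/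

section Free

variable {ι Y : Type u} [AddCommGroup Y] [Module k Y]

/-- The coaction on a direct sum of copies of a coalgebra. -/
noncomputable def freeCoact (ι : Type u) : (ι →₀ A) →ₗ[k] A ⊗[k] (ι →₀ A) :=
  Finsupp.lsum k fun i => (Finsupp.lsingle i).lTensor A ∘ₗ Coalgebra.comul

theorem freeCoact_single (i : ι) (a : A) : freeCoact (k := k) ι (Finsupp.single i a) =
    (Finsupp.lsingle i).lTensor A (Coalgebra.comul (R := k) a) :=
  Finsupp.lsum_single ..

theorem coact_lsum (ρ : Y →ₗ[k] A ⊗[k] Y) (f : ι → A →ₗ[k] Y)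
    (hf : ∀ i a, ρ (f i a) = (f i).lTensor A (Coalgebra.comul (R := k) a)) (m : ι →₀ A) :
    ρ (Finsupp.lsum k f m) = (Finsupp.lsum k f).lTensor A (freeCoact ι m) := by
  induction m using Finsupp.induction_linear with
  | zero => simp
  | add x y hx hy => simp only [map_add, hx, hy]
  | single i a =>
    have e : Finsupp.lsum k f ∘ₗ Finsupp.lsingle i = f i := by ext; simp
    rw [freeCoact_single, Finsupp.lsum_single, hf, ← LinearMap.lTensor_comp_apply, e]

theorem freeCoact_coassoc (m : ι →₀ A) :
    TensorProduct.assoc k A A (ι →₀ A)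
      ((Coalgebra.comul (R := k)).rTensor _ (freeCoact ι m)) =
      (freeCoact ι).lTensor A (freeCoact ι m) := by
  induction m using Finsupp.induction_linear with
  | zero => simp
  | add x y hx hy => simp only [map_add, hx, hy]
  | single i a =>
    have e : ∀ w : A ⊗[k] A, TensorProduct.assoc k A A (ι →₀ A)
        ((Coalgebra.comul (R := k)).rTensor _ ((Finsupp.lsingle i).lTensor A w)) =
        ((Finsupp.lsingle i).lTensor A).lTensor A
          (TensorProduct.assoc k A A A ((Coalgebra.comul (R := k)).rTensor _ w)) := by
      intro w
      induction w with
      | zero => simp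
      | add x y hx hy => simp only [map_add, hx, hy]
      | tmul x y =>
        simp only [LinearMap.lTensor_tmul, LinearMap.rTensor_tmul]
        induction Coalgebra.comul (R := k) x with
        | zero => simp
        | add x y hx hy => simp only [map_add, add_tmul, hx, hy]
        | tmul x y => simp
    have e2 : freeCoact (k := k) (A := A) ι ∘ₗ Finsupp.lsingle i =
        (Finsupp.lsingle i).lTensor A ∘ₗ Coalgebra.comul := by
      ext a
      exact freeCoact_single i a
    rw [freeCoact_single, e, Coalgebra.coassoc_apply, ← LinearMap.lTensor_comp_apply, ← e2,
      LinearMap.lTensor_comp_apply]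

theorem freeCoact_counit (m : ι →₀ A) :
    sliceLeft (ι →₀ A) (Coalgebra.counit (R := k)) (freeCoact ι m) = m := by
  induction m using Finsupp.induction_linear with
  | zero => simp
  | add x y hx hy => simp only [map_add, hx, hy]
  | single i a =>
    rw [freeCoact_single, sliceLeft_lTensor, ← coHit_apply, coHit_counit]
    rfl

end Free

/-- The coproduct of copies of the regular left comodule. -/
noncomputable def LeftComodule.free (ι : Type u) : LeftComodule k A where
  carrier := ι →₀ A
  coact := freeCoact ι
  coassoc := freeCoact_coassoc
  counit := freeCoact_counit

/-- The inclusion of a summand in a coproduct of copies of the regular left comodule. -/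
noncomputable def LeftComodule.freeInj (ι : Type u) (i : ι) :
    LeftComodule.regular k A ⟶ LeftComodule.free ι :=
  LeftComodule.Hom.mk (M := LeftComodule.regular k A) (N := LeftComodule.free ι)
    (Finsupp.lsingle i) (freeCoact_single (A := A) i)

/-- The linear map underlying a morphism from the regular comodule. -/
def LeftComodule.regularMap {X : LeftComodule k A} (f : LeftComodule.regular k A ⟶ X) :
    A →ₗ[k] X.carrier := LeftComodule.Hom.toLinearMap f

/-- The linear map underlying a morphism from a coproduct of copies of the regular comodule. -/
def LeftComodule.freeMap {ι : Type u} {X : LeftComodule k A} (f : LeftComodule.free ι ⟶ X) :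
    (ι →₀ A) →ₗ[k] X.carrier := LeftComodule.Hom.toLinearMap f

/-- The morphism out of a coproduct of copies of the regular left comodule induced by a family of
morphisms. -/
noncomputable def LeftComodule.freeDesc {ι : Type u} {X : LeftComodule k A}
    (f : ι → (LeftComodule.regular k A ⟶ X)) : LeftComodule.free ι ⟶ X :=
  LeftComodule.Hom.mk (M := LeftComodule.free ι)
    (Finsupp.lsum k fun i => LeftComodule.regularMap (f i))
    (coact_lsum (A := A) X.coact (fun i => LeftComodule.regularMap (f i)) fun i a =>
      LeftComodule.Hom.comm (f i) a)

theorem LeftComodule.freeMap_freeDesc_single {ι : Type u} {X : LeftComodule k A}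
    (f : ι → (LeftComodule.regular k A ⟶ X)) (i : ι) (a : A) :
    LeftComodule.freeMap (LeftComodule.freeDesc f) (Finsupp.single i a) =
      LeftComodule.regularMap (f i) a :=
  Finsupp.lsum_single ..

theorem LeftComodule.free_hom_ext {ι : Type u} {X : LeftComodule k A}
    {f g : LeftComodule.free ι ⟶ X}
    (h : ∀ i a, LeftComodule.freeMap f (Finsupp.single i a) =
      LeftComodule.freeMap g (Finsupp.single i a)) : f = g :=
  LeftComodule.Hom.ext (Finsupp.lhom_ext h : LeftComodule.freeMap f = LeftComodule.freeMap g)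

theorem LeftComodule.hom_ext {X Y : LeftComodule k A} {f g : X ⟶ Y}
    (h : ∀ x, f.toLinearMap x = g.toLinearMap x) : f = g :=
  LeftComodule.Hom.ext (LinearMap.ext h)

/-- The coproduct cofan of copies of the regular left comodule. -/
noncomputable def LeftComodule.freeCofan (ι : Type u) :
    Limits.Cofan (fun _ : ι => LeftComodule.regular k A) :=
  Limits.Cofan.mk (LeftComodule.free ι) (LeftComodule.freeInj ι)

/-- The cofan of inclusions is a coproduct. -/
noncomputable def LeftComodule.freeIsColimit (ι : Type u) :
    Limits.IsColimit (LeftComodule.freeCofan (k := k) (A := A) ι) :=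
  Limits.Cofan.IsColimit.mk _ (fun s => LeftComodule.freeDesc s.inj)
    (fun s i => LeftComodule.hom_ext (LeftComodule.freeMap_freeDesc_single s.inj i))
    (fun s m hm => LeftComodule.free_hom_ext fun i a => by
      rw [LeftComodule.freeMap_freeDesc_single]
      exact LinearMap.congr_fun (congrArg LeftComodule.Hom.toLinearMap (hm i)) a)

/-- Take one copy of `A` for each morphism `A ⟶ X` and the canonical map to `X`: two morphisms that
agree after it agree on the image of every `A ⟶ X`, hence on their span. -/
theorem isGenerator_of_forall_mem_span
    (h : ∀ (X : LeftComodule k A) (x : X.carrier),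
      x ∈ Submodule.span k {y | ∃ (f : LeftComodule.regular k A ⟶ X) (a : A),
        LeftComodule.regularMap f a = y}) :
    IsGenerator (LeftComodule.regular k A) := by
  intro X
  refine ⟨(LeftComodule.regular k A ⟶ X), LeftComodule.freeCofan _,
    ⟨LeftComodule.freeIsColimit _⟩, LeftComodule.freeDesc fun f => f, ⟨?_⟩⟩
  intro Z u v huv
  refine LeftComodule.hom_ext fun x => ?_
  have hx := h X x
  induction hx using Submodule.span_induction with
  | zero => simp
  | add x y _ _ hx hy => simp only [map_add, hx, hy]
  | smul c x _ hx => simp only [map_smul, hx]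
  | mem y hy =>
    obtain ⟨f, a, rfl⟩ := hy
    rw [← LeftComodule.freeMap_freeDesc_single (fun f => f) f a]
    exact LinearMap.congr_fun (congrArg LeftComodule.Hom.toLinearMap huv) (Finsupp.single f a)

/-- Every element of a left comodule lies in a finite dimensional subcomodule. -/
theorem LeftComodule.exists_finite_subcomodule (X : LeftComodule k A) (x : X.carrier) :
    ∃ W : Submodule k X.carrier, FiniteDimensional k W ∧ x ∈ W ∧
      ∀ f, ∀ w ∈ W, X.act f w ∈ W := by
  let φ : (A →ₗ[k] k) →ₗ[k] X.carrier :=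
    { toFun := fun f => X.act f x
      map_add' := fun f g => sliceLeft_add f g _
      map_smul' := fun c f => sliceLeft_smul c f _ }
  refine ⟨LinearMap.range φ, ?_, ⟨_, X.act_counit x⟩, ?_⟩
  · obtain ⟨W, _, hW⟩ := finite_range_slice (X.coact x)
    refine Submodule.finiteDimensional_of_le (S₂ := W) ?_
    rintro _ ⟨f, rfl⟩
    exact hW f
  · rintro f _ ⟨g, rfl⟩
    exact ⟨g ∘ₗ hit f, (X.act_act g f x).symm⟩

/-- For `w` in a finite dimensional subcomodule with basis `b_j` and coaction `w ↦ ∑ c_j(w) ⊗ b_j`,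
the map `d ↦ ∑ g(c_j(w))(d) b_j` is a morphism from the regular comodule. A functional `u` vanishing
on all images of morphisms satisfies `g(∑ u(b_j) c_j(w)) = 0`; injectivity of `g` and the counit
then give `u(w) = 0`. -/
theorem HasTails.isGenerator (h : HasTails k A) :
    IsGenerator (LeftComodule.regular k A) := by
  refine isGenerator_of_forall_mem_span fun X x => ?_
  obtain ⟨W, _, hx, hW⟩ := X.exists_finite_subcomodule x
  let b := Module.finBasis k W
  obtain ⟨p, hp⟩ := LinearMap.exists_leftInverse_of_injective W.subtype W.ker_subtype
  let l : Fin (Module.finrank k W) → X.carrier →ₗ[k] k := fun j => b.coord j ∘ₗ p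
  have hl : ∀ w ∈ W, ∑ j, l j w • (b j : X.carrier) = w := by
    intro w hw
    have h1 : p w = ⟨w, hw⟩ := LinearMap.congr_fun hp ⟨w, hw⟩
    have h2 := congrArg Subtype.val (b.sum_repr ⟨w, hw⟩)
    rw [AddSubmonoidClass.coe_finsetSum] at h2
    simp only [l, LinearMap.comp_apply, h1, b.coord_apply]
    exact h2
  have hco : ∀ w ∈ W, X.coact w = ∑ j, X.coeff (l j) w ⊗ₜ[k] (b j : X.carrier) := by
    intro w hw
    refine sliceLeft_ext fun f => ?_
    rw [map_sum]
    simp only [sliceLeft_tmul, ← X.apply_act]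
    exact (hl _ (hW f w hw)).symm
  obtain ⟨g, hg, hg0⟩ := h.exists_embedding
    (⨆ i, ⨆ j, k ∙ X.coeff (l j) (b i : X.carrier))
  have hmem : ∀ j, ∀ w ∈ W, X.coeff (l j) w ∈ ⨆ i, ⨆ j, k ∙ X.coeff (l j) (b i : X.carrier) := by
    intro j w hw
    rw [← hl w hw, map_sum]
    refine Submodule.sum_mem _ fun i _ => ?_
    rw [map_smul]
    exact Submodule.smul_mem _ _ (Submodule.mem_iSup_of_mem i (Submodule.mem_iSup_of_mem j
      (Submodule.mem_span_singleton_self _)))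
  -- With `c_m` the coefficient map of `m`, this is a contraction of `Δ(c_m(w)) = ∑ c_j(w) ⊗
  -- c_m(b_j)`.
  have hhit : ∀ (f : A →ₗ[k] k) (m : X.carrier →ₗ[k] k), ∀ w ∈ W,
      hit f (X.coeff m w) = ∑ j, f (X.coeff m (b j)) • X.coeff (l j) w := by
    intro f m w hw
    refine eq_of_forall_functional (k := k) fun u => ?_
    change (u ∘ₗ hit f) (X.coeff m w) = _
    rw [← X.apply_act, ← X.act_act, X.apply_act]
    conv_lhs => rw [← hl _ (hW u w hw)]
    simp [X.apply_act, mul_comm]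
  let θ : X.carrier → (A →ₗ[k] X.carrier) := fun w =>
    ∑ j, (g (X.coeff (l j) w)).smulRight (b j : X.carrier)
  have hθ : ∀ w d, θ w d = ∑ j, g (X.coeff (l j) w) d • (b j : X.carrier) := by
    intro w d
    simp [θ]
  have hcomm : ∀ w ∈ W, ∀ d, X.coact (θ w d) = (θ w).lTensor A (Coalgebra.comul (R := k) d) := by
    intro w hw d
    refine sliceLeft_ext fun f => ?_
    rw [sliceLeft_lTensor, ← coHit_apply, hθ, hθ]
    change X.act f _ = _
    -- Here the linearity of `g` over the dual algebra becomes the compatibility of `θ w` with the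
    -- coactions.
    have e : ∀ j, g (X.coeff (l j) w) (coHit f d) =
        ∑ i, f (X.coeff (l j) (b i)) • g (X.coeff (l i) w) d := by
      intro j
      rw [← apply_hit]
      change (f ∘ₗ hit (g (X.coeff (l j) w))) d = _
      rw [← hg _ (hmem j w hw), hhit f _ w hw]
      simp
    simp only [e, Finset.sum_smul, map_sum, map_smul]
    rw [Finset.sum_comm]
    refine Finset.sum_congr rfl fun j _ => ?_
    conv_lhs => rw [← hl _ (hW f _ (b j).2)]
    rw [Finset.smul_sum]
    refine Finset.sum_congr rfl fun i _ => ?_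
    rw [X.apply_act, smul_smul, smul_eq_mul, mul_comm]
  by_contra hcon
  -- If `x` were outside the span of the images, some functional would vanish on the span but not at
  -- `x`.
  obtain ⟨u, hux, hu⟩ := Submodule.exists_le_ker_of_notMem hcon
  apply hux
  have hz : ∀ w ∈ W, X.coeff u w = 0 := by
    intro w hw
    have e : X.coeff u w = ∑ j, u (b j) • X.coeff (l j) w := by
      refine eq_of_forall_functional (k := k) fun f => ?_
      rw [← X.apply_act]
      conv_lhs => rw [← hl _ (hW f w hw)]
      simp [X.apply_act, mul_comm]
    rw [e]
    refine hg0 _ (Submodule.sum_mem _ fun j _ => Submodule.smul_mem _ _ (hmem j w hw)) ?_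
    ext d
    have h0 : u (θ w d) = 0 := hu (Submodule.subset_span
      ⟨(⟨θ w, hcomm w hw⟩ : LeftComodule.Hom (LeftComodule.regular k A) X), d, rfl⟩)
    rw [hθ] at h0
    simpa [mul_comm] using h0
  rw [← X.act_counit x, X.apply_act, hz x hx, map_zero]

end Criterion

/-! ### The extended quiver and its subcoalgebra -/

namespace PathCoalgebra

/-! ### Path coalgebras: actions on paths and morphisms of quivers -/

section Basic

variable {k V : Type u} [Field k] [Quiver.{u} V]

theorem comul_of {a b : V} (p : Quiver.Path a b) :
    Coalgebra.comul (R := k) (of k p) = splitSum p fun _ x y => of k x ⊗ₜ[k] of k y :=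
  lift_of k _ p

theorem hit_of (f : PathCoalgebra k V →ₗ[k] k) {a b : V} (p : Quiver.Path a b) :
    hit f (of k p) = splitSum p fun _ x y => f (of k y) • of k x := by
  rw [hit_apply, comul_of, map_splitSum]
  simp only [sliceRight_tmul]

theorem coHit_of (f : PathCoalgebra k V →ₗ[k] k) {a b : V} (p : Quiver.Path a b) :
    coHit f (of k p) = splitSum p fun _ x y => f (of k x) • of k y := by
  rw [coHit_apply, comul_of, map_splitSum]
  simp only [sliceLeft_tmul]

theorem hit_of_cons (f : PathCoalgebra k V →ₗ[k] k) {a b c : V} (p : Quiver.Path a b)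
    (e : b ⟶ c) : hit f (of k (p.cons e)) = f (of k (.nil : Quiver.Path c c)) • of k (p.cons e) +
      splitSum p fun _ x y => f (of k (y.cons e)) • of k x := by
  rw [hit_of, splitSum_cons]

theorem hit_of_nil (f : PathCoalgebra k V →ₗ[k] k) (a : V) :
    hit f (of k (.nil : Quiver.Path a a)) =
      f (of k (.nil : Quiver.Path a a)) • of k (.nil : Quiver.Path a a) := by
  rw [hit_of, splitSum_nil]

theorem coHit_of_nil (f : PathCoalgebra k V →ₗ[k] k) (a : V) :
    coHit f (of k (.nil : Quiver.Path a a)) =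
      f (of k (.nil : Quiver.Path a a)) • of k (.nil : Quiver.Path a a) := by
  rw [coHit_of, splitSum_nil]

theorem lift_apply {M : Type u} [AddCommGroup M] [Module k M]
    (g : ∀ a b : V, Quiver.Path a b → M) (x : PathCoalgebra k V) :
    lift k g x = ∑ z ∈ Finsupp.support x, Finsupp.toFun x z • g z.1 z.2.1 z.2.2 := rfl

theorem eq_sum_support (x : PathCoalgebra k V) :
    x = ∑ z ∈ Finsupp.support x, Finsupp.toFun x z • of k z.2.2 := by
  refine Eq.trans ?_ (lift_apply (fun a b z => of k z) x)
  have : PathCoalgebra.lift k (fun a b z => of k z) =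
      (LinearMap.id : PathCoalgebra k V →ₗ[k] _) := ext_of k fun a b z => lift_of k _ z
  rw [this, LinearMap.id_apply]

theorem mapQuiver_of {W : Type u} [Quiver.{u} W] (F : V ⥤q W) {a b : V} (p : Quiver.Path a b) :
    mapQuiver k F (of k p) = of k (F.mapPath p) := lift_of k _ p

theorem mapQuiver_comp_apply {W U : Type u} [Quiver.{u} W] [Quiver.{u} U] (F : V ⥤q W)
    (G : W ⥤q U) (x : PathCoalgebra k V) :
    mapQuiver k G (mapQuiver k F x) = mapQuiver k (F ⋙q G) x := by
  have : (mapQuiver k G).toLinearMap ∘ₗ (mapQuiver k F).toLinearMap =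
      (mapQuiver k (F ⋙q G)).toLinearMap := by
    apply ext_of
    intro a b p
    change mapQuiver k G (mapQuiver k F (of k p)) = mapQuiver k (F ⋙q G) (of k p)
    rw [mapQuiver_of, mapQuiver_of, mapQuiver_of, Prefunctor.mapPath_comp_apply]
    rfl
  exact LinearMap.congr_fun this x

theorem mapQuiver_injective {W : Type u} [Quiver.{u} W] (F : V ⥤q W)
    (h : Function.Injective fun z : TotalPath V =>
      (⟨F.obj z.1, F.obj z.2.1, F.mapPath z.2.2⟩ : TotalPath W)) :
    Function.Injective (mapQuiver k F) := by
  have e : (mapQuiver k F).toLinearMap = Finsupp.lmapDomain k k (fun z : TotalPath V =>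
      (⟨F.obj z.1, F.obj z.2.1, F.mapPath z.2.2⟩ : TotalPath W)) := by
    apply ext_of
    intro a b p
    exact (mapQuiver_of F p).trans (Finsupp.mapDomain_single (f := fun z : TotalPath V =>
      (⟨F.obj z.1, F.obj z.2.1, F.mapPath z.2.2⟩ : TotalPath W)) (a := ⟨a, b, p⟩)
      (b := (1 : k))).symm
  have h2 := Finsupp.mapDomain_injective (M := k) h
  intro x y hxy
  refine h2 ?_
  have h3 : (mapQuiver k F).toLinearMap x = (mapQuiver k F).toLinearMap y := hxy
  rw [e] at h3
  exact h3

theorem cons_sigma_eq {a b c a' b' c' : V} {p : Quiver.Path a b} {e : b ⟶ c}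
    {p' : Quiver.Path a' b'} {e' : b' ⟶ c'}
    (h : (⟨a, c, p.cons e⟩ : TotalPath V) = ⟨a', c', p'.cons e'⟩) :
    (⟨a, b, p⟩ : TotalPath V) = ⟨a', b', p'⟩ ∧
      (⟨b, c, e⟩ : Σ x y : V, x ⟶ y) = ⟨b', c', e'⟩ := by
  cases h
  exact ⟨rfl, rfl⟩

theorem cons_sigma_eq_of {a b c a' b' c' : V} {p : Quiver.Path a b} {e : b ⟶ c}
    {p' : Quiver.Path a' b'} {e' : b' ⟶ c'} (h1 : (⟨a, b, p⟩ : TotalPath V) = ⟨a', b', p'⟩)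
    (h2 : (⟨b, c, e⟩ : Σ x y : V, x ⟶ y) = ⟨b', c', e'⟩) :
    (⟨a, c, p.cons e⟩ : TotalPath V) = ⟨a', c', p'.cons e'⟩ := by
  cases h1
  cases h2
  rfl

theorem length_eq_of_sigma_eq {a b a' b' : V} {p : Quiver.Path a b} {p' : Quiver.Path a' b'}
    (h : (⟨a, b, p⟩ : TotalPath V) = ⟨a', b', p'⟩) : p.length = p'.length := by
  cases h
  rfl

/-- Paths are compared by peeling off the last arrow. Arrows and paths are packed with their
endpoints, so that equality makes sense before the endpoints are identified. -/
theorem mapPath_sigma_injective {W : Type u} [Quiver.{u} W] (F : V ⥤q W)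
    (h0 : Function.Injective F.obj)
    (h1 : ∀ {v w v' w' : V} (e : v ⟶ w) (e' : v' ⟶ w'),
      (⟨F.obj v, F.obj w, F.map e⟩ : Σ x y : W, x ⟶ y) = ⟨F.obj v', F.obj w', F.map e'⟩ →
        (⟨v, w, e⟩ : Σ x y : V, x ⟶ y) = ⟨v', w', e'⟩) :
    Function.Injective fun z : TotalPath V =>
      (⟨F.obj z.1, F.obj z.2.1, F.mapPath z.2.2⟩ : TotalPath W) := by
  rintro ⟨a, b, p⟩ ⟨a', b', p'⟩ h
  induction p generalizing b' with
  | nil =>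
    cases p' with
    | nil =>
      have := h0 (congrArg Sigma.fst h)
      subst this
      rfl
    | cons p' e' => exact absurd (length_eq_of_sigma_eq h) (by simp)
  | cons p e ih =>
    cases p' with
    | nil => exact absurd (length_eq_of_sigma_eq h) (by simp)
    | cons p' e' =>
      obtain ⟨h2, h3⟩ := cons_sigma_eq h
      exact cons_sigma_eq_of (ih _ p' h2) (h1 e e' h3)

end Basic

end PathCoalgebra

open PathCoalgebra

section Bar

variable {k V : Type u} [Field k] [Quiver.{u} V] {C : Subcoalgebra k (PathCoalgebra k V)}

/-- The arrow from `b` to `e_F` given by an element `p ∈ F` ending at `b`. -/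
def tailHom (F : IndepSet C) {p : PathCoalgebra k V} (hp : p ∈ F.1) {b : V} (h : EndsAt p b) :
    (barInclusion C).obj b ⟶ BarVertex.tail F :=
  (⟨p, hp, h⟩ : {p : PathCoalgebra k V // p ∈ F.1 ∧ EndsAt p b})

open Classical in
/-- Right multiplication with the arrow `α_{p,F}`. -/
noncomputable def consTail (F : IndepSet C) {p : PathCoalgebra k V} (hp : p ∈ F.1) :
    PathCoalgebra k V →ₗ[k] PathCoalgebra k (BarVertex C) :=
  lift k fun _ b z => if h : EndsAt p b then
    of k (((barInclusion C).mapPath z).cons (tailHom F hp h)) else 0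

theorem consTail_of (F : IndepSet C) {p : PathCoalgebra k V} (hp : p ∈ F.1) {a b : V}
    (h : EndsAt p b) (z : Quiver.Path a b) : consTail F hp (of k z) =
      of k (((barInclusion C).mapPath z).cons (tailHom F hp h)) := by
  rw [consTail, lift_of, dif_pos h]

theorem consTail_of_not (F : IndepSet C) {p : PathCoalgebra k V} (hp : p ∈ F.1) {a b : V}
    (h : ¬ EndsAt p b) (z : Quiver.Path a b) : consTail F hp (of k z) = 0 := by
  rw [consTail, lift_of, dif_neg h]

theorem tailElement_eq (F : IndepSet C) :
    tailElement F = ∑ p : {p // p ∈ F.1}, consTail F p.2 p.1 := by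
  refine Finset.sum_congr rfl fun p _ => ?_
  conv_rhs => rw [consTail, lift_apply]
  rw [← Finset.sum_coe_sort (Finsupp.support p.1)]
  refine Finset.sum_congr rfl fun x _ => ?_
  rw [dif_pos (F.endsAt p.2 x.2)]
  rfl

/-- The terms of `Δ(zα)` are `zα ⊗ e_F` and `x ⊗ yα` for `xy = z`. As `y` ends where `z` does, `yα`
is defined exactly when `zα` is. -/
theorem hit_consTail (F : IndepSet C) {p : PathCoalgebra k V} (hp : p ∈ F.1)
    (g : PathCoalgebra k (BarVertex C) →ₗ[k] k) (x : PathCoalgebra k V) :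
    hit g (consTail F hp x) =
      g (of k (.nil : Quiver.Path (BarVertex.tail F) (BarVertex.tail F))) • consTail F hp x +
        mapQuiver k (barInclusion C) (hit (g ∘ₗ consTail F hp) x) := by
  have : hit g ∘ₗ consTail F hp =
      g (of k (.nil : Quiver.Path (BarVertex.tail F) (BarVertex.tail F))) • consTail F hp +
        (mapQuiver k (barInclusion C)).toLinearMap ∘ₗ hit (g ∘ₗ consTail F hp) := by
    apply ext_of
    intro a b z
    simp only [LinearMap.comp_apply, LinearMap.add_apply, LinearMap.smul_apply]
    rw [hit_of _ z, map_splitSum]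
    by_cases h : EndsAt p b
    · rw [consTail_of F hp h, hit_of_cons, splitSum_mapPath]
      congr 2
      ext c x y : 3
      rw [LinearMap.comp_apply, consTail_of F hp h, map_smul]
      congr 1
      exact (mapQuiver_of _ x).symm
    · rw [consTail_of_not F hp h]
      have e : (fun (c : V) (x : Quiver.Path a c) (y : Quiver.Path c b) =>
          (mapQuiver k (barInclusion C)).toLinearMap
            ((g ∘ₗ consTail F hp) (of k y) • of k x)) = fun c x y => 0 := by
        ext c x y : 3
        rw [LinearMap.comp_apply, consTail_of_not F hp h]
        simp
      rw [e]
      simp [splitSum]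
  exact LinearMap.congr_fun this x

theorem hit_tailElement (F : IndepSet C) (g : PathCoalgebra k (BarVertex C) →ₗ[k] k) :
    hit g (tailElement F) =
      g (of k (.nil : Quiver.Path (BarVertex.tail F) (BarVertex.tail F))) • tailElement F +
        mapQuiver k (barInclusion C)
          (∑ p : {p // p ∈ F.1}, hit (g ∘ₗ consTail F p.2) p.1) := by
  rw [tailElement_eq, map_sum, map_sum, Finset.smul_sum, ← Finset.sum_add_distrib]
  exact Finset.sum_congr rfl fun p _ => hit_consTail F p.2 g p.1

/-- The three kinds of elements span a subspace stable under both actions, that is, a subcoalgebra,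
and it contains the generators of `bar C`. Linear conditions on `bar C` can therefore be checked on
these elements. -/
theorem bar_le (S : Submodule k (PathCoalgebra k (BarVertex C)))
    (h1 : ∀ x ∈ C.toSubmodule, mapQuiver k (barInclusion C) x ∈ S)
    (h2 : ∀ F : IndepSet C, of k (.nil : Quiver.Path (BarVertex.tail F) (BarVertex.tail F)) ∈ S)
    (h3 : ∀ (F : IndepSet C) (f : PathCoalgebra k (BarVertex C) →ₗ[k] k),
      coHit f (tailElement F) ∈ S) : (bar C).toSubmodule ≤ S := by
  let T : Set (PathCoalgebra k (BarVertex C)) := (mapQuiver k (barInclusion C) '' C.toSubmodule) ∪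
    (Set.range fun F : IndepSet C =>
      of k (.nil : Quiver.Path (BarVertex.tail F) (BarVertex.tail F))) ∪
    Set.range fun z : IndepSet C × (PathCoalgebra k (BarVertex C) →ₗ[k] k) =>
      coHit (k := k) z.2 (tailElement z.1)
  have m1 : ∀ x ∈ (C.map (mapQuiver k (barInclusion C))).toSubmodule, x ∈ Submodule.span k T := by
    rintro _ ⟨x, hx, rfl⟩
    exact Submodule.subset_span (Or.inl (Or.inl ⟨x, hx, rfl⟩))
  have m2 : ∀ F : IndepSet C, of k (.nil : Quiver.Path (BarVertex.tail F) (BarVertex.tail F)) ∈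
      Submodule.span k T := fun F => Submodule.subset_span (Or.inl (Or.inr ⟨F, rfl⟩))
  have m3 : ∀ (F : IndepSet C) (f : PathCoalgebra k (BarVertex C) →ₗ[k] k),
      coHit f (tailElement F) ∈ Submodule.span k T :=
    fun F f => Submodule.subset_span (Or.inr ⟨(F, f), rfl⟩)
  have cl1 : ∀ f : PathCoalgebra k (BarVertex C) →ₗ[k] k, ∀ x ∈ Submodule.span k T,
      hit f x ∈ Submodule.span k T := by
    intro f x hx
    refine (Submodule.span_le.2 ?_ : Submodule.span k T ≤ (Submodule.span k T).comap (hit f)) hx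
    rintro _ ((⟨x, hx, rfl⟩ | ⟨F, rfl⟩) | ⟨⟨F, g⟩, rfl⟩)
    · exact m1 _ ((C.map (mapQuiver k (barInclusion C))).hit_mem f ⟨x, hx, rfl⟩)
    · change hit f _ ∈ Submodule.span k T
      rw [hit_of_nil]
      exact Submodule.smul_mem _ _ (m2 F)
    · change hit f (coHit g (tailElement F)) ∈ Submodule.span k T
      -- `f ⇀ (q_F ↼ g) = (f ⇀ q_F) ↼ g`, and `f ⇀ q_F` is a multiple of `q_F` plus an element of
      -- the image of `C`.
      rw [hit_coHit, hit_tailElement, map_add, map_smul]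
      refine Submodule.add_mem _ (Submodule.smul_mem _ _ (m3 F g))
        (m1 _ ((C.map (mapQuiver k (barInclusion C))).coHit_mem g ⟨_, ?_, rfl⟩))
      exact Submodule.sum_mem _ fun p _ => C.hit_mem _ (F.2.1 p.1 p.2).1
  have cl2 : ∀ f : PathCoalgebra k (BarVertex C) →ₗ[k] k, ∀ x ∈ Submodule.span k T,
      coHit f x ∈ Submodule.span k T := by
    intro f x hx
    refine (Submodule.span_le.2 ?_ : Submodule.span k T ≤ (Submodule.span k T).comap (coHit f)) hx
    rintro _ ((⟨x, hx, rfl⟩ | ⟨F, rfl⟩) | ⟨⟨F, g⟩, rfl⟩)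
    · exact m1 _ ((C.map (mapQuiver k (barInclusion C))).coHit_mem f ⟨x, hx, rfl⟩)
    · change coHit f _ ∈ Submodule.span k T
      rw [coHit_of_nil]
      exact Submodule.smul_mem _ _ (m2 F)
    · change coHit f (coHit g (tailElement F)) ∈ Submodule.span k T
      rw [coHit_coHit]
      exact m3 F _
  refine (Subcoalgebra.generated_le (Subcoalgebra.ofHit (Submodule.span k T) cl1 cl2) ?_).trans
    (Submodule.span_le.2 ?_)
  · rintro _ (⟨x, hx, rfl⟩ | ⟨F, rfl⟩)
    · exact m1 _ ⟨x, hx, rfl⟩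
    · have := m3 F (Coalgebra.counit (R := k))
      rwa [coHit_counit] at this
  · rintro _ ((⟨x, hx, rfl⟩ | ⟨F, rfl⟩) | ⟨⟨F, g⟩, rfl⟩)
    exacts [h1 x hx, h2 F, h3 F g]

theorem map_mem_bar {x : PathCoalgebra k V} (hx : x ∈ C.toSubmodule) :
    mapQuiver k (barInclusion C) x ∈ (bar C).toSubmodule :=
  Subcoalgebra.subset_generated _ (Or.inl ⟨x, hx, rfl⟩)

theorem tailElement_mem_bar (F : IndepSet C) : tailElement F ∈ (bar C).toSubmodule :=
  Subcoalgebra.subset_generated _ (Or.inr ⟨F, rfl⟩)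

end Bar

/-! ### The union of the extended quivers -/

section Union

variable {k V : Type u} [Field k] [Quiver.{u} V] (C : Subcoalgebra k (PathCoalgebra k V))

/-- The inclusion in `T(Q)` of `T^{n+1}(Q)`, viewed as the extension of `T^n(Q)`. -/
noncomputable def barToUnion (n : ℕ) : BarVertex (stage C n).C ⥤q UnionVertex C :=
  toUnion C (n + 1)

/-- Vertices coming from the `n`th stage are in the base or carry a tag smaller than `n`. -/
theorem toUnionObj_ne_tail {n m : ℕ} (h : n ≤ m) (w : (stage C n).V)
    (F : IndepSet (stage C m).C) : toUnionObj C n w ≠ .tail m F := by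
  induction n with
  | zero => exact fun h => by cases h
  | succ n ih =>
    change BarVertex (stage C n).C at w
    cases w with
    | old w => exact ih (by omega) w
    | tail G =>
      intro h1
      injection (h1 : UnionVertex.tail n G = .tail m F)
      omega

theorem toUnionObj_injective (n : ℕ) : Function.Injective (toUnionObj C n) := by
  induction n with
  | zero =>
    intro v w h
    injection (h : UnionVertex.base v = .base w)
  | succ n ih =>
    intro v w h
    change BarVertex (stage C n).C at v w
    cases v with
    | old v =>
      cases w with
      | old w => exact congrArg BarVertex.old (ih h)
      | tail G => exact absurd h (toUnionObj_ne_tail C le_rfl v G)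
    | tail F =>
      cases w with
      | old w => exact absurd h.symm (toUnionObj_ne_tail C le_rfl w F)
      | tail G =>
        injection (h : UnionVertex.tail n F = .tail n G) with _ h2
        exact congrArg BarVertex.tail h2

theorem union_tail_sigma_ext {n : ℕ} {F G : IndepSet (stage C n).C} {x y : UnionVertex C}
    {e : x ⟶ UnionVertex.tail n F} {f : y ⟶ UnionVertex.tail n G}
    (h : (⟨x, _, e⟩ : Σ x y : UnionVertex C, x ⟶ y) = ⟨y, _, f⟩) :
    x = y ∧ F = G ∧ e.1 = f.1 := by
  cases h
  exact ⟨rfl, rfl, rfl⟩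

theorem base_sigma_ext {v w v' w' : V} {e : v ⟶ w} {e' : v' ⟶ w'}
    (h : (⟨UnionVertex.base v, UnionVertex.base w, e⟩ : Σ x y : UnionVertex C, x ⟶ y) =
      ⟨.base v', .base w', e'⟩) : (⟨v, w, e⟩ : Σ x y : V, x ⟶ y) = ⟨v', w', e'⟩ := by
  cases h
  rfl

theorem old_sigma_congr {D : Subcoalgebra k (PathCoalgebra k V)} {v w v' w' : V} {e : v ⟶ w}
    {e' : v' ⟶ w'} (h : (⟨v, w, e⟩ : Σ x y : V, x ⟶ y) = ⟨v', w', e'⟩) :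
    (⟨.old v, .old w, e⟩ : Σ x y : BarVertex D, x ⟶ y) = ⟨.old v', .old w', e'⟩ := by
  cases h
  rfl

/-- The target decides whether an arrow is old, where induction applies, or a tail arrow, which is
determined by its source, `F` and `p`. -/
theorem toUnionMap_injective (n : ℕ) {v w v' w' : (stage C n).V} (e : v ⟶ w) (e' : v' ⟶ w')
    (h : (⟨toUnionObj C n v, toUnionObj C n w, toUnionMap C n e⟩ :
        Σ x y : UnionVertex C, x ⟶ y) = ⟨toUnionObj C n v', toUnionObj C n w', toUnionMap C n e'⟩) :
    (⟨v, w, e⟩ : Σ x y : (stage C n).V, x ⟶ y) = ⟨v', w', e'⟩ := by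
  induction n with
  | zero => exact base_sigma_ext C h
  | succ n ih =>
    have ht : toUnionObj C (n + 1) w = toUnionObj C (n + 1) w' :=
      congrArg (fun z : (Σ x y : UnionVertex C, x ⟶ y) => z.2.1) h
    have hw := toUnionObj_injective C _ ht
    subst hw
    change BarVertex (stage C n).C at v w v'
    cases w with
    | old w =>
      cases v with
      | tail F => exact PEmpty.elim e
      | old v =>
        cases v' with
        | tail F => exact PEmpty.elim e'
        | old v' => exact old_sigma_congr (ih e e' h)
    | tail G =>
      cases v with
      | tail F => exact PEmpty.elim e
      | old v =>
        cases v' with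
        | tail F => exact PEmpty.elim e'
        | old v' =>
          obtain ⟨h1, -, h3⟩ := union_tail_sigma_ext C h
          have := toUnionObj_injective C _ h1
          injection this with this
          subst this
          have h4 : e = e' := Subtype.ext h3
          rw [h4]

/-- The inclusion of the path coalgebra of `T^n(Q)` in that of `T(Q)`. -/
noncomputable def stageMap (n : ℕ) :
    PathCoalgebra k (stage C n).V →ₗc[k] PathCoalgebra k (UnionVertex C) :=
  mapQuiver k (toUnion C n)

/-- The inclusion of the path coalgebra of the extension of `T^n(Q)` in that of `T(Q)`. -/
noncomputable def barMap (n : ℕ) :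
    PathCoalgebra k (BarVertex (stage C n).C) →ₗc[k] PathCoalgebra k (UnionVertex C) :=
  mapQuiver k (barToUnion C n)

theorem barMap_barInclusion (n : ℕ) (x : PathCoalgebra k (stage C n).V) :
    barMap C n (mapQuiver k (barInclusion (stage C n).C) x) = stageMap C n x :=
  mapQuiver_comp_apply _ _ x

theorem stageMap_injective (n : ℕ) : Function.Injective (stageMap C n) :=
  mapQuiver_injective _ (mapPath_sigma_injective _ (toUnionObj_injective C n)
    (toUnionMap_injective C n))

theorem barMap_injective (n : ℕ) : Function.Injective (barMap C n) := stageMap_injective C (n + 1)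

/-! ### Functionals dual to the added arrows -/

variable {C}

/-- The pair `(p, F)` for the arrow `α_{p,F}`. -/
def tailLabel {x : UnionVertex C} : {y : UnionVertex C} → (x ⟶ y) →
    Option (Σ n, IndepSet (stage C n).C × PathCoalgebra k (stage C n).V)
  | .base _, _ => none
  | .tail n F, e => some ⟨n, F, e.1⟩

open Classical in
/-- The coefficient of a path in the functional dual to the arrow `α_{p,F}`. -/
noncomputable def tailCoeff (n : ℕ) (F : IndepSet (stage C n).C)
    (p : PathCoalgebra k (stage C n).V) {x : UnionVertex C} :
    {y : UnionVertex C} → Quiver.Path x y → k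
  | _, .nil => 0
  | _, .cons q e => if q.length = 0 ∧ tailLabel e = some ⟨n, F, p⟩ then 1 else 0

/-- The functional dual to the arrow `α_{p,F}`. -/
noncomputable def tailFunctional (n : ℕ) (F : IndepSet (stage C n).C)
    (p : PathCoalgebra k (stage C n).V) : PathCoalgebra k (UnionVertex C) →ₗ[k] k :=
  lift k fun _ _ z => tailCoeff n F p z

theorem tailFunctional_nil (n : ℕ) (F : IndepSet (stage C n).C)
    (p : PathCoalgebra k (stage C n).V) (x : UnionVertex C) :
    tailFunctional n F p (of k (.nil : Quiver.Path x x)) = 0 := lift_of k _ _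

open Classical in
theorem tailFunctional_cons (n : ℕ) (F : IndepSet (stage C n).C)
    (p : PathCoalgebra k (stage C n).V) {x y z : UnionVertex C} (q : Quiver.Path x y) (e : y ⟶ z) :
    tailFunctional n F p (of k (q.cons e)) =
      if q.length = 0 ∧ tailLabel e = some ⟨n, F, p⟩ then 1 else 0 := lift_of k _ _

/-- Arrows of the original quiver carry no tail label. This starts the induction over the stages. -/
theorem tailFunctional_stageMap_zero (n : ℕ) (F : IndepSet (stage C n).C)
    (p : PathCoalgebra k (stage C n).V) :
    tailFunctional n F p ∘ₗ (stageMap C 0).toLinearMap = 0 := by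
  apply ext_of
  intro a b z
  change tailFunctional n F p (stageMap C 0 (of k z)) = 0
  rw [stageMap, mapQuiver_of]
  cases z with
  | nil => exact tailFunctional_nil n F p _
  | cons q e =>
    rw [Prefunctor.mapPath_cons, tailFunctional_cons, if_neg]
    rintro ⟨-, h⟩
    cases h

theorem mapPath_length {V W : Type u} [Quiver.{u} V] [Quiver.{u} W] (F : V ⥤q W) {a b : V}
    (p : Quiver.Path a b) : (F.mapPath p).length = p.length := by
  induction p with
  | nil => rfl
  | cons p e ih => simp [ih]

open Classical in
theorem tailFunctional_consTail (n : ℕ) (F : IndepSet (stage C n).C)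
    (p : PathCoalgebra k (stage C n).V) (m : ℕ) (G : IndepSet (stage C m).C)
    {r : PathCoalgebra k (stage C m).V} (hr : r ∈ G.1) {a b : (stage C m).V}
    (h : EndsAt r b) (z : Quiver.Path a b) :
    tailFunctional n F p (barMap C m (consTail G hr (of k z))) =
      if z.length = 0 ∧ (⟨m, G, r⟩ : Σ n, IndepSet (stage C n).C ×
        PathCoalgebra k (stage C n).V) = ⟨n, F, p⟩ then 1 else 0 := by
  rw [consTail_of G hr h, barMap, mapQuiver_of, Prefunctor.mapPath_cons, tailFunctional_cons,
    mapPath_length, mapPath_length]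
  have : tailLabel ((barToUnion C m).map (tailHom G hr h)) = some ⟨m, G, r⟩ := rfl
  simp only [this, Option.some_inj]

theorem hit_consTail_of_ne (n : ℕ) (F : IndepSet (stage C n).C)
    (p : PathCoalgebra k (stage C n).V) (m : ℕ) (G : IndepSet (stage C m).C)
    {r : PathCoalgebra k (stage C m).V} (hr : r ∈ G.1)
    (hne : (⟨m, G, r⟩ : Σ n, IndepSet (stage C n).C ×
        PathCoalgebra k (stage C n).V) ≠ ⟨n, F, p⟩) :
    (tailFunctional n F p ∘ₗ (barMap C m).toLinearMap) ∘ₗ consTail G hr = 0 := by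
  apply ext_of
  intro a b z
  by_cases h : EndsAt r b
  · change tailFunctional n F p (barMap C m (consTail G hr (of k z))) = 0
    rw [tailFunctional_consTail n F p m G hr h, if_neg (fun h => hne h.2)]
  · rw [LinearMap.comp_apply, consTail_of_not G hr h]
    simp

theorem splitSum_length_right {k V : Type u} [Field k] [Quiver.{u} V] {a b : V}
    (p : Quiver.Path a b) :
    (splitSum p fun _ x y => (if y.length = 0 then (1 : k) else 0) • of k x) = of k p := by
  cases p with
  | nil => simp [splitSum_nil]
  | cons p e =>
    rw [splitSum_cons]
    simp [splitSum]

/-- The functional `y ↦ ρ_p(y α_{p,F})` is `1` on the trivial path at the target of `p` and `0` on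
longer paths ending there, so it acts on `p` like the counit. -/
theorem hit_consTail_self (n : ℕ) (F : IndepSet (stage C n).C)
    {p : PathCoalgebra k (stage C n).V} (hp : p ∈ F.1) :
    hit ((tailFunctional n F p ∘ₗ (barMap C n).toLinearMap) ∘ₗ consTail F hp) p = p := by
  obtain ⟨b, hb⟩ := (F.2.1 p hp).2.2
  set g := (tailFunctional n F p ∘ₗ (barMap C n).toLinearMap) ∘ₗ consTail F hp with hg
  have e : ∀ z ∈ Finsupp.support p, hit g (of k z.2.2) = of k z.2.2 := by
    rintro ⟨a, b', z⟩ hz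
    have hz' : EndsAt p b' := F.endsAt hp hz
    rw [hit_of]
    refine Eq.trans ?_ (splitSum_length_right z)
    congr 1
    ext c x y : 3
    change tailFunctional n F p (barMap C n (consTail F hp (of k y))) • _ = _
    rw [tailFunctional_consTail n F p n F hp hz']
    simp
  conv_lhs => rw [eq_sum_support p]
  conv_rhs => rw [eq_sum_support p]
  rw [map_sum]
  refine Finset.sum_congr rfl fun z hz => ?_
  rw [map_smul, e z hz]

/-- The arrow dual to the functional does not occur in `q_G`. The stage index is part of the label,
so sets from different stages never share an arrow. -/
theorem hit_tailFunctional_tailElement_of_ne (n : ℕ) (F : IndepSet (stage C n).C)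
    (p : PathCoalgebra k (stage C n).V) (m : ℕ) (G : IndepSet (stage C m).C)
    (hne : (⟨m, G⟩ : Σ n, IndepSet (stage C n).C) ≠ ⟨n, F⟩) :
    hit (tailFunctional n F p ∘ₗ (barMap C m).toLinearMap) (tailElement G) = 0 := by
  rw [hit_tailElement]
  have h1 : (tailFunctional n F p ∘ₗ (barMap C m).toLinearMap)
      (of k (.nil : Quiver.Path (BarVertex.tail G) (BarVertex.tail G))) = 0 := by
    change tailFunctional n F p (barMap C m _) = 0
    rw [barMap, mapQuiver_of]
    exact tailFunctional_nil n F p _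
  rw [h1, zero_smul, zero_add, Finset.sum_eq_zero, map_zero]
  intro r _
  rw [hit_consTail_of_ne n F p m G r.2, hit_zero]
  intro h
  apply hne
  cases h
  rfl

theorem hit_tailFunctional_tailElement (n : ℕ) (F : IndepSet (stage C n).C)
    {p : PathCoalgebra k (stage C n).V} (hp : p ∈ F.1) :
    hit (tailFunctional n F p ∘ₗ (barMap C n).toLinearMap) (tailElement F) =
      mapQuiver k (barInclusion (stage C n).C) p := by
  rw [hit_tailElement]
  have h1 : (tailFunctional n F p ∘ₗ (barMap C n).toLinearMap)
      (of k (.nil : Quiver.Path (BarVertex.tail F) (BarVertex.tail F))) = 0 := by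
    change tailFunctional n F p (barMap C n _) = 0
    rw [barMap, mapQuiver_of]
    exact tailFunctional_nil n F p _
  rw [h1, zero_smul, zero_add, Finset.sum_eq_single ⟨p, hp⟩]
  · rw [hit_consTail_self]
  · intro r _ hr
    rw [hit_consTail_of_ne n F p n F r.2, hit_zero]
    intro h
    apply hr
    simp only [Sigma.mk.injEq, heq_eq_eq, Prod.mk.injEq, true_and] at h
    exact Subtype.ext h
  · intro h
    exact absurd (Finset.mem_univ _) h

/-- The elements `d` for which the family `ρ_p ⇀ d`, with `ρ_p` dual to `α_{p,F}`, is of the form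
`p ↼ a`. -/
noncomputable def tailSubmodule (n : ℕ) (F : IndepSet (stage C n).C) :
    Submodule k (PathCoalgebra k (UnionVertex C)) where
  carrier := {d | ∃ a : PathCoalgebra k (UnionVertex C) →ₗ[k] k, ∀ p ∈ F.1,
    hit (tailFunctional n F p) d = coHit a (stageMap C n p)}
  add_mem' := by
    rintro x y ⟨a, ha⟩ ⟨b, hb⟩
    exact ⟨a + b, fun p hp => by rw [map_add, ha p hp, hb p hp, coHit_add]⟩
  zero_mem' := ⟨0, fun p _ => by simp⟩
  smul_mem' := by
    rintro c x ⟨a, ha⟩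
    exact ⟨c • a, fun p hp => by rw [map_smul, ha p hp, coHit_smul]⟩

theorem mem_tailSubmodule_of_hit_eq_zero {n : ℕ} {F : IndepSet (stage C n).C}
    {d : PathCoalgebra k (UnionVertex C)}
    (h : ∀ p ∈ F.1, hit (tailFunctional n F p) d = 0) : d ∈ tailSubmodule n F :=
  ⟨0, fun p hp => by rw [h p hp, coHit_zero]⟩

/-- By induction on the stage and `bar_le`, only the elements `q_G ↼ f` matter. The two actions
commute, so `ρ_p ⇀ (q_G ↼ f)` equals `(ρ_p ⇀ q_G) ↼ f`, which is `p ↼ f` if `G` is `F` at the same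
stage and `0` otherwise; the functional does not depend on `p`. -/
theorem stageMap_mem_tailSubmodule (n : ℕ) (F : IndepSet (stage C n).C) (m : ℕ)
    {x : PathCoalgebra k (stage C m).V} (hx : x ∈ (stage C m).C.toSubmodule) :
    stageMap C m x ∈ tailSubmodule n F := by
  induction m with
  | zero =>
    refine mem_tailSubmodule_of_hit_eq_zero fun p hp => ?_
    rw [← map_hit, tailFunctional_stageMap_zero, hit_zero, map_zero]
  | succ m ih =>
    have key : (bar (stage C m).C).toSubmodule ≤
        (tailSubmodule n F).comap (barMap C m).toLinearMap := by
      refine bar_le _ ?_ ?_ ?_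
      · intro y hy
        change barMap C m _ ∈ tailSubmodule n F
        rw [barMap_barInclusion]
        exact ih hy
      · intro G
        change barMap C m _ ∈ tailSubmodule n F
        refine mem_tailSubmodule_of_hit_eq_zero fun p hp => ?_
        rw [barMap, mapQuiver_of]
        refine (hit_of_nil _ _).trans ?_
        rw [tailFunctional_nil, zero_smul]
      · intro G f
        change barMap C m _ ∈ tailSubmodule n F
        by_cases hne : (⟨m, G⟩ : Σ n, IndepSet (stage C n).C) = ⟨n, F⟩
        · cases hne
          -- `f` is defined only on the extension of the `n`th stage; composing with a retraction
          -- `s` extends it to the path coalgebra of `T(Q)`.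
          obtain ⟨s, hs⟩ := LinearMap.exists_leftInverse_of_injective (barMap C n).toLinearMap
            (LinearMap.ker_eq_bot.2 (barMap_injective C n))
          refine ⟨f ∘ₗ s, fun p hp => ?_⟩
          rw [← map_hit, hit_coHit, hit_tailFunctional_tailElement n F hp, ← barMap_barInclusion,
            ← map_coHit (barMap C n), LinearMap.comp_assoc, hs, LinearMap.comp_id]
        · refine mem_tailSubmodule_of_hit_eq_zero fun p hp => ?_
          rw [← map_hit, hit_coHit, hit_tailFunctional_tailElement_of_ne n F p m G hne, map_zero,
            map_zero]
    exact key hx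

theorem tailClosure_le_tailSubmodule (n : ℕ) (F : IndepSet (stage C n).C) :
    (tailClosure C).toSubmodule ≤ tailSubmodule n F := by
  refine iSup_le fun m => ?_
  rintro _ ⟨x, hx, rfl⟩
  exact stageMap_mem_tailSubmodule n F m hx

theorem stageMap_mem_tailClosure (n : ℕ) {x : PathCoalgebra k (stage C n).V}
    (hx : x ∈ (stage C n).C.toSubmodule) : stageMap C n x ∈ (tailClosure C).toSubmodule :=
  Submodule.mem_iSup_of_mem
    (p := fun n => ((stage C n).C.map (mapQuiver k (toUnion C n))).toSubmodule)
    n ⟨x, hx, rfl⟩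

theorem barMap_tailElement_mem_tailClosure (n : ℕ) (F : IndepSet (stage C n).C) :
    barMap C n (tailElement F) ∈ (tailClosure C).toSubmodule :=
  stageMap_mem_tailClosure (n + 1) (tailElement_mem_bar F)

theorem monotone_stage (C : Subcoalgebra k (PathCoalgebra k V)) : Monotone fun n =>
    ((stage C n).C.map (stageMap C n)).toSubmodule := by
  refine monotone_nat_of_le_succ fun n => ?_
  rintro _ ⟨x, hx, rfl⟩
  exact ⟨_, map_mem_bar hx, barMap_barInclusion C n x⟩

/-- A finite dimensional subspace of the tail closure lies in a stage. -/
theorem exists_stage_of_finiteDimensional (M : Submodule k (PathCoalgebra k (UnionVertex C)))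
    [FiniteDimensional k M] (hM : M ≤ (tailClosure C).toSubmodule) :
    ∃ n, M ≤ ((stage C n).C.map (stageMap C n)).toSubmodule := by
  have hfg : M.FG := (Submodule.fg_iff_finiteDimensional M).2 inferInstance
  obtain ⟨S, rfl⟩ := hfg
  have h : ∀ x ∈ S, ∃ n, x ∈ ((stage C n).C.map (stageMap C n)).toSubmodule := by
    intro x hx
    exact (Submodule.mem_iSup_of_directed _ (monotone_stage C).directed_le).1
      (hM (Submodule.subset_span hx))
  choose! N hN using h
  refine ⟨S.sup N, Submodule.span_le.2 fun x hx => ?_⟩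
  exact monotone_stage C (Finset.le_sup hx) (hN x hx)

end Union

/-! ### Finite dimensional subspaces and independent sets of multipaths -/

section Multipath

variable {k V : Type u} [Field k] [Quiver.{u} V]

open Classical in
/-- The functional picking out the trivial path at `v`, for paths starting at `v`. -/
noncomputable def sourceFunctional (v : V) : PathCoalgebra k V →ₗ[k] k :=
  lift k fun a _ z => if a = v then counitMap k (of k z) else 0

open Classical in
/-- The functional picking out the trivial path at `v`, for paths ending at `v`. -/
noncomputable def targetFunctional (v : V) : PathCoalgebra k V →ₗ[k] k :=
  lift k fun _ b z => if b = v then counitMap k (of k z) else 0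

open Classical in
-- Only the factorisation with trivial right factor contributes, and that factor is the target
-- vertex.
theorem hit_targetFunctional (v : V) {a b : V} (z : Quiver.Path a b) :
    hit (targetFunctional v) (of k z) = if b = v then of k z else 0 := by
  rw [hit_of]
  simp only [targetFunctional, lift_of]
  split_ifs
  · exact splitSum_counit_right k z fun _ x => of k x
  · simp [splitSum]

open Classical in
theorem coHit_sourceFunctional (v : V) {a b : V} (z : Quiver.Path a b) :
    coHit (sourceFunctional v) (of k z) = if a = v then of k z else 0 := by
  rw [coHit_of]
  simp only [sourceFunctional, lift_of]
  split_ifs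
  · exact splitSum_counit_left k z fun _ y => of k y
  · simp [splitSum]

/-- The projection to the span of the paths with given source and target. -/
noncomputable def component (t : V × V) : PathCoalgebra k V →ₗ[k] PathCoalgebra k V :=
  coHit (sourceFunctional t.1) ∘ₗ hit (targetFunctional t.2)

open Classical in
theorem component_of (t : V × V) {a b : V} (z : Quiver.Path a b) :
    component t (of k z) = if t = (a, b) then of k z else 0 := by
  rw [component, LinearMap.comp_apply, hit_targetFunctional]
  obtain ⟨v, w⟩ := t
  simp only [Prod.mk.injEq]
  by_cases h1 : b = w
  · rw [if_pos h1, coHit_sourceFunctional]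
    by_cases h2 : a = v
    · rw [if_pos h2, if_pos ⟨h2.symm, h1.symm⟩]
    · rw [if_neg h2, if_neg fun h => h2 h.1.symm]
  · rw [if_neg h1, if_neg fun h => h1 h.2.symm, map_zero]

theorem isMultipath_component (t : V × V) (x : PathCoalgebra k V) :
    IsMultipath (component t x) := by
  classical
  have h : component t x ∈ Finsupp.supported k k {z : TotalPath V | (z.1, z.2.1) = t} := by
    rw [eq_sum_support x, map_sum]
    refine Submodule.sum_mem _ fun z _ => ?_
    rw [map_smul, component_of]
    refine Submodule.smul_mem _ _ ?_
    split_ifs with h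
    · exact Finsupp.single_mem_supported k (1 : k) h.symm
    · exact Submodule.zero_mem _
  replace h := (Finsupp.mem_supported k _).1 h
  exact ⟨⟨t.1, fun z hz => congrArg Prod.fst (h hz)⟩, t.2, fun z hz => congrArg Prod.snd (h hz)⟩

theorem exists_sum_component (x : PathCoalgebra k V) :
    ∃ T : Finset (V × V), ∑ t ∈ T, component t x = x := by
  classical
  refine ⟨(Finsupp.support x).image fun z => (z.1, z.2.1), ?_⟩
  have e : ∀ t : V × V, component t x = ∑ z ∈ Finsupp.support x,
      Finsupp.toFun x z • if t = (z.1, z.2.1) then of k z.2.2 else 0 := by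
    intro t
    conv_lhs => rw [eq_sum_support x]
    simp only [map_sum, map_smul, component_of]
  conv_rhs => rw [eq_sum_support x]
  simp only [e]
  rw [Finset.sum_comm]
  refine Finset.sum_congr rfl fun z hz => ?_
  rw [← Finset.smul_sum, Finset.sum_ite_eq', if_pos]
  exact Finset.mem_image_of_mem (fun z : TotalPath V => (z.1, z.2.1)) hz

/-- The component with given source and target is obtained by acting with functionals on both sides,
and a subcoalgebra is stable under both actions. -/
theorem le_span_multipath (C : Subcoalgebra k (PathCoalgebra k V)) :
    C.toSubmodule ≤ Submodule.span k {p | p ∈ C.toSubmodule ∧ IsMultipath p} := by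
  intro x hx
  obtain ⟨T, hT⟩ := exists_sum_component x
  rw [← hT]
  refine Submodule.sum_mem _ fun t _ => Submodule.subset_span
    ⟨C.coHit_mem _ (C.hit_mem _ hx), isMultipath_component t x⟩

/-! ### Right coideals generated by finite sets -/

/-- The sum of the subspaces `{f ⇀ x}` for `x ∈ G`. -/
noncomputable def hitSpan {A : Type u} [AddCommGroup A] [Module k A] [Coalgebra k A]
    (G : Finset A) : Submodule k A := ⨆ x ∈ G, Subcoalgebra.hitRange x

section HitSpan

variable {A : Type u} [AddCommGroup A] [Module k A] [Coalgebra k A] {G : Finset A}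

theorem hitRange_le_hitSpan {x : A} (hx : x ∈ G) :
    Subcoalgebra.hitRange (k := k) x ≤ hitSpan G :=
  le_iSup₂ (f := fun x (_ : x ∈ G) => Subcoalgebra.hitRange (k := k) x) x hx

theorem span_le_hitSpan : Submodule.span k (G : Set A) ≤ hitSpan G :=
  Submodule.span_le.2 fun x hx => hitRange_le_hitSpan hx (Subcoalgebra.self_mem_hitRange x)

theorem hit_mem_hitSpan (f : A →ₗ[k] k) {y : A} (hy : y ∈ hitSpan (k := k) G) :
    hit f y ∈ hitSpan (k := k) G := by
  refine (iSup₂_le fun x hx => ?_ : hitSpan (k := k) G ≤ (hitSpan G).comap (hit f)) hy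
  rintro _ ⟨g, rfl⟩
  refine hitRange_le_hitSpan hx ⟨f ∘ₗ hit g, ?_⟩
  exact (hit_hit f g x).symm

theorem hitSpan_le_iff {W : Submodule k A} :
    hitSpan G ≤ W ↔ ∀ x ∈ G, Subcoalgebra.hitRange x ≤ W := iSup₂_le_iff

theorem hitSpan_le_hitSpan {G' : Finset A} (h : ∀ x ∈ G, x ∈ hitSpan (k := k) G') :
    hitSpan (k := k) G ≤ hitSpan G' := by
  refine hitSpan_le_iff.2 fun x hx => ?_
  rintro _ ⟨f, rfl⟩
  exact hit_mem_hitSpan f (h x hx)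

theorem exists_sum_of_mem_hitSpan {y : A} (hy : y ∈ hitSpan (k := k) G) :
    ∃ f : {x // x ∈ G} → A →ₗ[k] k, ∑ x, hit (f x) x.1 = y := by
  classical
  have h : hitSpan (k := k) G ≤ LinearMap.range (∑ x : {x // x ∈ G},
      hitOn (k := k) x.1 ∘ₗ LinearMap.proj x) := by
    refine hitSpan_le_iff.2 fun x hx => ?_
    rintro _ ⟨f, rfl⟩
    refine ⟨Pi.single ⟨x, hx⟩ f, ?_⟩
    rw [LinearMap.sum_apply, Finset.sum_eq_single ⟨x, hx⟩]
    · simp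
    · intro y _ hy
      simp [hy]
    · intro h
      exact absurd (Finset.mem_univ _) h
  obtain ⟨f, hf⟩ := h hy
  refine ⟨f, ?_⟩
  rw [← hf, LinearMap.sum_apply]
  rfl

end HitSpan

/-- A finite dimensional subspace of `C` is contained in the right coideal generated by a finite
independent set of multipaths. -/
theorem exists_indepSet (C : Subcoalgebra k (PathCoalgebra k V))
    (S : Finset (PathCoalgebra k V)) (hS : ∀ x ∈ S, x ∈ C.toSubmodule) :
    ∃ F : IndepSet C, ∀ x ∈ S, x ∈ hitSpan (k := k) F.1 := by
  classical
  have hex : ∃ n, ∃ G : Finset (PathCoalgebra k V), G.card = n ∧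
      (∀ p ∈ G, p ∈ C.toSubmodule ∧ IsMultipath p) ∧ ∀ x ∈ S, x ∈ hitSpan (k := k) G := by
    have h1 : ∀ x ∈ S, ∃ G : Finset (PathCoalgebra k V),
        (G : Set _) ⊆ {p | p ∈ C.toSubmodule ∧ IsMultipath p} ∧
          x ∈ Submodule.span k (G : Set (PathCoalgebra k V)) := fun x hx =>
      Submodule.mem_span_finite_of_mem_span (le_span_multipath C (hS x hx))
    choose! G hG hG' using h1
    refine ⟨_, S.biUnion G, rfl, fun p hp => ?_, fun x hx => ?_⟩
    · obtain ⟨x, hx, hp⟩ := Finset.mem_biUnion.1 hp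
      exact hG x hx hp
    · refine span_le_hitSpan (Submodule.span_mono ?_ (hG' x hx))
      exact_mod_cast Finset.subset_biUnion_of_mem G hx
  -- A generating set of least cardinality: by `key`, no element lies in the coideal generated by
  -- the others, since it could be dropped.
  obtain ⟨G, hcard, hG, hGS⟩ := Nat.find_spec hex
  have key : ∀ x ∈ G, x ∉ hitSpan (k := k) (G.erase x) := by
    intro x hx hmem
    refine Nat.find_min hex (m := (G.erase x).card) ?_ ⟨G.erase x, rfl, fun p hp =>
      hG p (Finset.mem_of_mem_erase hp), fun y hy => hitSpan_le_hitSpan (fun z hz => ?_) (hGS y hy)⟩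
    · rw [← hcard]
      exact Finset.card_erase_lt_of_mem hx
    · by_cases hzx : z = x
      · rwa [hzx]
      · exact span_le_hitSpan (Submodule.subset_span (Finset.mem_erase.2 ⟨hzx, hz⟩))
  refine ⟨⟨G, hG, ?_, fun x hx => ?_⟩, hGS⟩
  -- The span of the other elements lies in the coideal they generate, so `key` gives linear
  -- independence.
  · rw [linearIndepOn_iff_notMem_span]
    intro x hx hmem
    refine key x hx (span_le_hitSpan ?_)
    rwa [Set.image_id, ← Finset.coe_erase] at hmem
  · refine Set.Subset.antisymm ?_ ?_
    · rintro y ⟨hy, hyG⟩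
      by_contra hne
      -- If `y ≠ x` lay in the coideal of `x`, then `y` would lie in the coideal generated by `G`
      -- without `y`.
      refine key y hyG (hitRange_le_hitSpan (Finset.mem_erase.2 ⟨fun h => hne h.symm, hx⟩) ?_)
      exact C.rightCoidealSpan_le_hitRange (hG x hx).1 hy
    · rintro _ rfl
      exact ⟨C.mem_rightCoidealSpan_self _, hx⟩

end Multipath

/-! ### The tail closure satisfies the criterion -/

section Main

variable {k V : Type u} [Field k] [Quiver.{u} V]

/-- For a subspace lying in the `n`th stage, `P` consists of the elements of an independent set `F`
of that stage, `q` is `q_F`, which appears one stage later, and `ρ` consists of the functionals dual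
to the arrows into `e_F`. -/
theorem hasTails_tailClosure (C : Subcoalgebra k (PathCoalgebra k V)) :
    HasTails k (tailClosure C).toSubmodule := by
  classical
  intro M hM
  obtain ⟨n, hn⟩ := exists_stage_of_finiteDimensional (C := C)
    (M.map (tailClosure C).toSubmodule.subtype) (Submodule.map_subtype_le _ _)
  obtain ⟨T, hT⟩ := (Submodule.fg_iff_finiteDimensional
    (M.map (tailClosure C).toSubmodule.subtype)).2 inferInstance
  have hs : ∀ x ∈ T, ∃ y ∈ (stage C n).C.toSubmodule, stageMap C n y = x := fun x hx =>
    hn (hT ▸ Submodule.subset_span hx)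
  choose! s hs1 hs2 using hs
  obtain ⟨F, hF⟩ := exists_indepSet (stage C n).C (T.image s) fun y hy => by
    obtain ⟨x, hx, rfl⟩ := Finset.mem_image.1 hy
    exact hs1 x hx
  -- `r` extends functionals from the `n`th stage to `T(Q)`, which transports the action on the
  -- stage to the action on the tail closure.
  obtain ⟨r, hr⟩ := LinearMap.exists_leftInverse_of_injective (stageMap C n).toLinearMap
    (LinearMap.ker_eq_bot.2 (stageMap_injective C n))
  refine ⟨{p // p ∈ F.1}, inferInstance,
    fun p => ⟨stageMap C n p.1, stageMap_mem_tailClosure n (F.2.1 p.1 p.2).1⟩,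
    fun p => tailFunctional n F p.1 ∘ₗ (tailClosure C).toSubmodule.subtype,
    ⟨barMap C n (tailElement F), barMap_tailElement_mem_tailClosure n F⟩, ?_, ?_, ?_⟩
  · intro x hx
    have hx' : (x : PathCoalgebra k (UnionVertex C)) ∈
        (hitSpan (k := k) F.1).map (stageMap C n).toLinearMap := by
      have h1 : (x : PathCoalgebra k (UnionVertex C)) ∈ Submodule.span k (T : Set _) :=
        hT ▸ ⟨x, hx, rfl⟩
      have h2 : Submodule.span k (T : Set (PathCoalgebra k (UnionVertex C))) ≤
          (hitSpan (k := k) F.1).map (stageMap C n).toLinearMap := by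
        refine Submodule.span_le.2 fun y hy => ?_
        exact ⟨s y, hF _ (Finset.mem_image_of_mem s hy), hs2 y hy⟩
      exact h2 h1
    obtain ⟨y, hy, hyx⟩ := hx'
    obtain ⟨f, rfl⟩ := exists_sum_of_mem_hitSpan hy
    refine ⟨fun p => (f p ∘ₗ r) ∘ₗ (tailClosure C).toSubmodule.subtype, Subtype.ext ?_⟩
    rw [← hyx, AddSubmonoidClass.coe_finsetSum, map_sum]
    refine Finset.sum_congr rfl fun p _ => ?_
    rw [Subcoalgebra.coe_hit, ← map_hit, LinearMap.comp_assoc, hr, LinearMap.comp_id]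
    rfl
  · intro p
    refine Subtype.ext ?_
    rw [Subcoalgebra.coe_hit, ← map_hit, hit_tailFunctional_tailElement n F p.2,
      barMap_barInclusion]
  · intro d
    obtain ⟨a, ha⟩ := tailClosure_le_tailSubmodule n F d.2
    refine ⟨a ∘ₗ (tailClosure C).toSubmodule.subtype, fun p => Subtype.ext ?_⟩
    rw [Subcoalgebra.coe_hit, Subcoalgebra.coe_coHit]
    exact ha p.1 p.2

end Main

theorem mainTheorem2 {k V : Type u} [Field k] [Quiver.{u} V]
    (C : Subcoalgebra k (PathCoalgebra k V)) (hC : IsAdmissible C) :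
    IsGenerator (LeftComodule.regular k (tailClosure C).toSubmodule) ∧
      IsLeftFQcF k (tailClosure C).toSubmodule := by
  exact ⟨(hasTails_tailClosure C).isGenerator, (hasTails_tailClosure C).isLeftFQcF⟩
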